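/- Let $n\ge 0$ and let $\mathbb C^{n,1}$ be $\mathbb C^{n+1}$ with the Hermitian form $\langle z,w\rangle=-z_0\bar w_0+z_1\bar w_1+\dots+z_n\bar w_n$. Let $\mathrm U(n,1)$ be its unitary group and $\mathrm{PU}(n,1)=\mathrm U(n,1)/Z(\mathrm U(n,1))$ the group of holomorphic isometries of complex hyperbolic space $\mathbf H^n_{\mathbb C}$, the set of lines spanned by vectors $v$ with $\langle v,v\rangle<0$; its boundary $\partial\mathbf H^n_{\mathbb C}$ is the set of lines spanned by vectors $v\neq0$ with $\langle v,v\rangle=0$. An element of a group is an involution if $g^2=1$, and reversible if it is conjugate to its inverse. An element of $\mathrm U(n,1)$ is - elliptic if it has a fixed point in $\mathbf H^n_{\mathbb C}$; hyperbolic if it has exactly two fixed points in $\mathbf H^n_{\mathbb C}\cup\partial\mathbf H^n_{\mathbb C}$, both in $\partial\mathbf H^n_{\mathbb C}$; parabolic if it has exactly one fixed point in $\mathbf H^n_{\mathbb C}\cup\partial\mathbf H^n_{\mathbb C}$, and this point is in $\partial\mathbf H^n_{\mathbb C}$; - an ellipto-translation (for $d=2$), respectively ellipto-parabolic (for $d=3$),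 if it is parabolic and not unipotent and there are an invariant orthogonal decomposition $\mathbb C^{n,1}=\mathbb U\oplus\mathbb W$ and a $\mu\in\mathbb C$ with $|\mu|=1$ such that $\dim\mathbb U=d$, the form is non-degenerate and indefinite on $\mathbb U$, the characteristic and the minimal polynomial of the restriction to $\mathbb U$ are both $(x-\mu)^d$, and the restriction to $\mathbb W$ is semisimple; - a complex $k$-reflection if it has an eigenvalue $\lambda\ne1$ of multiplicity $k+1$ with an eigenvector $v$ such that $\langle v,v\rangle<0$, and the eigenvalue $1$ with multiplicity $n-k$ (multiplicities are dimensions of eigenspaces; $0\le k\le n$). An element of $\mathrm{PU}(n,1)$ is said to have one of the properties of this list if some lift of it to $\mathrm U(n,1)$ does. Let $T\in\mathrm{PU}(n,1)$. Then, for some $k\le2$, $T$ is a product in $\mathrm{PU}(n,1)$ of a complex $k$-reflection and at most four involutions. One can take $k=0$ if $T$ is elliptic, $k=1$ if $T$ is hyperbolic or an ellipto-translation, and $k=2$ if $T$ is ellipto-parabolic and $n>2$. The same holds, with the same values of $k$, with "at most two reversible elements of $\mathrm{PU}(n,1)$" in place of "at most four involutions". -/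

import Mathlib

noncomputable section

open scoped Matrix LinearAlgebra.Projectivization

namespace CHyp

/-- The underlying space `ℂ^{n,1}`, with coordinates `z 0, …, z n`. -/
abbrev V (n : ℕ) : Type := Fin (n + 1) → ℂ

/-- `J = diag(-1, 1, …, 1)`. -/
def J (n : ℕ) : Matrix (Fin (n + 1)) (Fin (n + 1)) ℂ :=
  Matrix.diagonal fun i => if i = 0 then -1 else 1

/-- The Hermitian form `⟨z, w⟩ = w̄ᵗ J z = - z₀ w̄₀ + z₁ w̄₁ + ⋯ + zₙ w̄ₙ` of signature `(n, 1)`. -/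
def herm {n : ℕ} (z w : V n) : ℂ := star w ⬝ᵥ (J n *ᵥ z)

/-- The vector `z` is negative (time-like). Note that `⟨z, z⟩` is always real. -/
def IsNeg {n : ℕ} (z : V n) : Prop := (herm z z).re < 0

/-- The vector `z` is positive (space-like). -/
def IsPos {n : ℕ} (z : V n) : Prop := 0 < (herm z z).re

/-- The vector `z` is null (light-like). -/
def IsNull {n : ℕ} (z : V n) : Prop := herm z z = 0

/-- The group `U(n,1) = {A ∈ GL(n+1, ℂ) : Āᵗ J A = J}`. -/
def U (n : ℕ) : Subgroup (GL (Fin (n + 1)) ℂ) where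
  carrier := {A | (A : Matrix (Fin (n + 1)) (Fin (n + 1)) ℂ)ᴴ * J n *
    (A : Matrix (Fin (n + 1)) (Fin (n + 1)) ℂ) = J n}
  one_mem' := by simp
  mul_mem' := by
    intro A B hA hB
    simp only [Set.mem_ofPred_eq] at hA hB ⊢
    rw [Units.val_mul, Matrix.conjTranspose_mul]
    calc _ = (B : Matrix (Fin (n + 1)) (Fin (n + 1)) ℂ)ᴴ *
          ((A : Matrix (Fin (n + 1)) (Fin (n + 1)) ℂ)ᴴ * J n *
            (A : Matrix (Fin (n + 1)) (Fin (n + 1)) ℂ)) *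
          (B : Matrix (Fin (n + 1)) (Fin (n + 1)) ℂ) := by simp only [mul_assoc]
      _ = J n := by rw [hA, hB]
  inv_mem' := by
    intro A hA
    simp only [Set.mem_ofPred_eq] at hA ⊢
    have h1 : (A : Matrix (Fin (n + 1)) (Fin (n + 1)) ℂ) *
        ((A⁻¹ : GL (Fin (n + 1)) ℂ) : Matrix (Fin (n + 1)) (Fin (n + 1)) ℂ) = 1 := A.mul_inv
    have h2 := congrArg Matrix.conjTranspose h1
    rw [Matrix.conjTranspose_mul, Matrix.conjTranspose_one] at h2
    set B := ((A⁻¹ : GL (Fin (n + 1)) ℂ) : Matrix (Fin (n + 1)) (Fin (n + 1)) ℂ)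
    calc Bᴴ * J n * B
        = Bᴴ * ((A : Matrix (Fin (n + 1)) (Fin (n + 1)) ℂ)ᴴ * J n *
            (A : Matrix (Fin (n + 1)) (Fin (n + 1)) ℂ)) * B := by rw [hA]
      _ = (Bᴴ * (A : Matrix (Fin (n + 1)) (Fin (n + 1)) ℂ)ᴴ) * J n *
            ((A : Matrix (Fin (n + 1)) (Fin (n + 1)) ℂ) * B) := by simp only [mul_assoc]
      _ = J n := by rw [h1, h2, one_mul, mul_one]

/-- `PU(n,1) = U(n,1) / Z(U(n,1))`, the group of holomorphic isometries of complex hyperbolic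
`n`-space. -/
abbrev PU (n : ℕ) : Type := U n ⧸ Subgroup.center (U n)

/-- The linear transformation of `ℂ^{n,1}` given by an element of `U(n,1)`. -/
def lin {n : ℕ} (A : U n) : V n →ₗ[ℂ] V n :=
  Matrix.toLin' ((A : GL (Fin (n + 1)) ℂ) : Matrix (Fin (n + 1)) (Fin (n + 1)) ℂ)

theorem lin_injective {n : ℕ} (A : U n) : Function.Injective (lin A) := by
  intro x y h
  have h1 : ((A⁻¹ : U n) : GL (Fin (n + 1)) ℂ).val *
      ((A : GL (Fin (n + 1)) ℂ) : Matrix (Fin (n + 1)) (Fin (n + 1)) ℂ) = 1 :=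
    (A : GL (Fin (n + 1)) ℂ).inv_mul
  have h2 := congrArg (fun v => ((A⁻¹ : U n) : GL (Fin (n + 1)) ℂ).val *ᵥ v) h
  simpa [lin, Matrix.toLin'_apply, Matrix.mulVec_mulVec, h1] using h2

/-- The action of an element of `U(n,1)` on the projective space of `ℂ^{n,1}`. -/
def act {n : ℕ} (A : U n) : ℙ ℂ (V n) → ℙ ℂ (V n) :=
  Projectivization.map (lin A) (lin_injective A)

/-- Complex hyperbolic space: the image in projective space of the negative vectors. -/
def hyp (n : ℕ) : Set (ℙ ℂ (V n)) :=
  {p | ∃ (v : V n) (hv : v ≠ 0), IsNeg v ∧ Projectivization.mk ℂ v hv = p}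

/-- The boundary of complex hyperbolic space: the image of the non-zero null vectors. -/
def bdry (n : ℕ) : Set (ℙ ℂ (V n)) :=
  {p | ∃ (v : V n) (hv : v ≠ 0), IsNull v ∧ Projectivization.mk ℂ v hv = p}

/-- The fixed points of `A` on the closure of complex hyperbolic space. -/
def fixedPts {n : ℕ} (A : U n) : Set (ℙ ℂ (V n)) :=
  {p | p ∈ hyp n ∪ bdry n ∧ act A p = p}

/-- `A` has a fixed point in complex hyperbolic space. -/
def IsElliptic {n : ℕ} (A : U n) : Prop := ∃ p ∈ hyp n, act A p = p

/-- `A` fixes a single point of the closure, and this point lies on the boundary. -/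
def IsParabolic {n : ℕ} (A : U n) : Prop := ∃ p ∈ bdry n, fixedPts A = {p}

/-- `A` fixes exactly two points of the closure, and both lie on the boundary. -/
def IsHyperbolic {n : ℕ} (A : U n) : Prop :=
  ∃ p ∈ bdry n, ∃ q ∈ bdry n, p ≠ q ∧ fixedPts A = {p, q}

/-- All eigenvalues of `A` are `1`. -/
def IsUnipotent {n : ℕ} (A : U n) : Prop := IsNilpotent (lin A - 1)

/-- The Hermitian form restricted to `W` is non-degenerate and indefinite. -/
def IsIndefinite {n : ℕ} (W : Submodule ℂ (V n)) : Prop :=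
  (∀ x ∈ W, (∀ y ∈ W, herm x y = 0) → x = 0) ∧ (∃ x ∈ W, IsNeg x) ∧ (∃ x ∈ W, IsPos x)

/-- There are an invariant orthogonal decomposition `ℂ^{n,1} = P ⊕ W` and a `μ` of modulus `1` with
`P` indefinite of dimension `d`, such that the characteristic and the minimal polynomial of `A` on
`P` are both `(x - μ) ^ d`, and `A` is semisimple on `W`. -/
def HasBlock {n : ℕ} (d : ℕ) (A : U n) : Prop :=
  ∃ (P W : Submodule ℂ (V n)) (hP : ∀ x ∈ P, lin A x ∈ P) (hW : ∀ x ∈ W, lin A x ∈ W) (μ : ℂ),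
    IsCompl P W ∧ (∀ x ∈ P, ∀ y ∈ W, herm x y = 0) ∧
    IsIndefinite P ∧ Module.finrank ℂ P = d ∧ ‖μ‖ = 1 ∧
    ((lin A).restrict hP).charpoly = (Polynomial.X - Polynomial.C μ) ^ d ∧
    minpoly ℂ ((lin A).restrict hP) = (Polynomial.X - Polynomial.C μ) ^ d ∧
    Module.End.IsSemisimple ((lin A).restrict hW)

/-- Ellipto-translations: non-unipotent parabolic, with a block of dimension `2`. -/
def IsElliptoTranslation {n : ℕ} (A : U n) : Prop :=
  IsParabolic A ∧ ¬ IsUnipotent A ∧ HasBlock 2 A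

/-- Ellipto-parabolics: non-unipotent parabolic, with a block of dimension `3`. -/
def IsElliptoParabolic {n : ℕ} (A : U n) : Prop :=
  IsParabolic A ∧ ¬ IsUnipotent A ∧ HasBlock 3 A

/-- Complex `k`-reflections: there is an eigenvalue `μ ≠ 1`, of multiplicity `k + 1`, with a negative
eigenvector (so that it corresponds to the fixed points in hyperbolic space, and `|μ| = 1`), and the
eigenvalue `1` has multiplicity `n - k`. The two eigenspaces have total dimension `n + 1`, so they
span `ℂ^{n,1}` and geometric and algebraic multiplicities agree; they are orthogonal. -/
def IsReflection {n : ℕ} (k : ℕ) (A : U n) : Prop :=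
  ∃ μ : ℂ, μ ≠ 1 ∧
    (∃ v ∈ Module.End.eigenspace (lin A) μ, IsNeg v) ∧
    Module.finrank ℂ (Module.End.eigenspace (lin A) μ) = k + 1 ∧
    Module.finrank ℂ (Module.End.eigenspace (lin A) 1) + k = n

/-- An isometry `T ∈ PU(n,1)` has property `Q` if it has a lift to `U(n,1)` with property `Q`. -/
def Lifts {n : ℕ} (Q : U n → Prop) (T : PU n) : Prop :=
  ∃ A : U n, QuotientGroup.mk A = T ∧ Q A

/-- `T` is the product of a complex `k`-reflection and at most `m` elements of the set `S`. -/
def IsReflectionTimes {n : ℕ} (k m : ℕ) (S : Set (PU n)) (T : PU n) : Prop :=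
  ∃ R : PU n, Lifts (IsReflection k) R ∧
    ∃ l : List (PU n), l.length ≤ m ∧ (∀ g ∈ l, g ∈ S) ∧ T = R * l.prod

/-- The involutions of a group: the elements with `g ^ 2 = 1`. -/
def involutions (G : Type*) [Group G] : Set G := {g | g ^ 2 = 1}

/-- The reversible elements of a group: those conjugate to their inverse. -/
def reversibles (G : Type*) [Group G] : Set G := {g | IsConj g g⁻¹}

end CHyp

end

/-! The whole theorem reduces to a subspace `P` of dimension `d = k + 1 ≤ 3` that is invariant and
non-degenerate, contains a negative vector, and on which a lift `A` acts as a unimodular scalar `μ`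
times a product of four isometric involutions. The complement of `P` is positive definite, so `A` is
diagonal there in an orthonormal basis, with unimodular entries `b i`. Rescaling `A` by a unimodular
`c` is invisible in `PU(n,1)` and can make `∏ c * b i = ±1` with `c * μ ≠ 1`; then `diagonal (c b)`
is also a product of four unitary involutions. Gluing them to those on `P` gives `c A = R I₀ I₁ I₂
I₃`, where `R` is `c * μ` on `P` and `1` on its complement. This is `isReflectionTimes_of_family`.

Four kinds of `P` are needed: a negative eigenline, a plane spanned by two null eigenvectors, and
the spans of Jordan chains of length `2` and `3`. They suffice (`exists_isReflectionTimes`): if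
there is no negative eigenvector and all eigenvalues are unimodular, the generalized eigenspaces are
mutually orthogonal and `A` is not semisimple on one of them. There `A = μ (1 + N)` with `N`
nilpotent. Signature `(n,1)` forces `N ^ 3 = 0` (`pow_three_eq_zero_of_isometry`), and polarization
finds a chain of maximal length with non-degenerate span.

The version with reversible elements follows because a product of two involutions is reversible. -/

noncomputable section
open scoped Matrix LinearAlgebra.Projectivization
namespace CHyp

/-! ### The Hermitian form: null vectors and complements of negative vectors. -/

section Herm

variable {n : ℕ}

theorem herm_add_left (x y z : V n) : herm (x + y) z = herm x z + herm y z := by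
  simp [herm, Matrix.mulVec_add]

theorem herm_add_right (x y z : V n) : herm x (y + z) = herm x y + herm x z := by
  simp [herm, star_add, add_dotProduct]

theorem herm_smul_left (c : ℂ) (x y : V n) : herm (c • x) y = c * herm x y := by
  simp [herm, Matrix.mulVec_smul]

theorem herm_smul_right (c : ℂ) (x y : V n) : herm x (c • y) = star c * herm x y := by
  simp [herm, star_smul, smul_dotProduct]

theorem herm_eq_sum (x y : V n) :
    herm x y = -(x 0 * star (y 0)) + ∑ i : Fin n, x i.succ * star (y i.succ) := by
  simp only [herm, J, dotProduct, Matrix.mulVec_diagonal, Fin.sum_univ_succ, Pi.star_apply]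
  simp [Fin.succ_ne_zero, mul_comm]

theorem star_herm (x y : V n) : star (herm x y) = herm y x := by
  simp [herm_eq_sum, mul_comm]

@[simp] theorem herm_zero_left (x : V n) : herm 0 x = 0 := by simp [herm]

@[simp] theorem herm_zero_right (x : V n) : herm x 0 = 0 := by simp [herm]

theorem herm_neg_left (x y : V n) : herm (-x) y = -herm x y := by
  simp [herm, Matrix.mulVec_neg]

theorem herm_neg_right (x y : V n) : herm x (-y) = -herm x y := by
  simp [herm]

theorem herm_sub_left (x y z : V n) : herm (x - y) z = herm x z - herm y z := by
  simp [sub_eq_add_neg, herm_add_left, herm_neg_left]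

theorem herm_sub_right (x y z : V n) : herm x (y - z) = herm x y - herm x z := by
  simp [sub_eq_add_neg, herm_add_right, herm_neg_right]

theorem herm_sum_left {ι : Type*} (s : Finset ι) (f : ι → V n) (y : V n) :
    herm (∑ i ∈ s, f i) y = ∑ i ∈ s, herm (f i) y := by
  classical
  induction s using Finset.induction_on with
  | empty => simp
  | insert a s ha ih => simp [Finset.sum_insert ha, herm_add_left, ih]

theorem herm_sum_right {ι : Type*} (s : Finset ι) (f : ι → V n) (y : V n) :
    herm y (∑ i ∈ s, f i) = ∑ i ∈ s, herm y (f i) := by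
  classical
  induction s using Finset.induction_on with
  | empty => simp
  | insert a s ha ih => simp [Finset.sum_insert ha, herm_add_right, ih]

/-- `herm` in the first variable, as a linear functional. -/
def hermFunctional (y : V n) : V n →ₗ[ℂ] ℂ where
  toFun x := herm x y
  map_add' a b := herm_add_left a b y
  map_smul' c x := herm_smul_left c x y

@[simp] theorem hermFunctional_apply (x y : V n) : hermFunctional y x = herm x y := rfl

theorem herm_self_im (x : V n) : (herm x x).im = 0 := by
  have h := congrArg Complex.im (star_herm x x)
  simp only [Complex.star_def, Complex.conj_im] at h
  linarith

theorem herm_self_eq (x : V n) : herm x x = ((herm x x).re : ℂ) :=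
  Complex.ext rfl (by simp [herm_self_im])

theorem herm_self_re (x : V n) :
    (herm x x).re = -Complex.normSq (x 0) + ∑ i : Fin n, Complex.normSq (x i.succ) := by
  simp [herm_eq_sum, Complex.normSq_apply]

theorem herm_nondegenerate {x : V n} (h : ∀ y, herm x y = 0) : x = 0 := by
  funext i
  have h1 := h (Pi.single i 1)
  rw [herm_eq_sum] at h1
  rcases Fin.eq_zero_or_eq_succ i with rfl | ⟨j, rfl⟩
  · simpa [Pi.single_apply, Fin.succ_ne_zero] using h1
  · have : (0 : Fin (n + 1)) ≠ j.succ := (Fin.succ_ne_zero j).symm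
    simpa [Pi.single_apply, this, Finset.sum_ite_eq, apply_ite] using h1

theorem exists_isNeg (n : ℕ) : ∃ v : V n, IsNeg v :=
  ⟨Pi.single 0 1, by simp [IsNeg, herm_self_re, Fin.succ_ne_zero]⟩

/-- The form is positive definite on the hyperplane where coordinate `0` vanishes. -/
theorem apply_zero_ne_zero_of_isNull {x : V n} (hx : IsNull x) (h : x ≠ 0) : x 0 ≠ 0 := by
  intro h0
  have h1 : (herm x x).re = 0 := by rw [hx]; rfl
  rw [herm_self_re, h0] at h1
  simp only [map_zero, neg_zero, zero_add] at h1
  rw [Finset.sum_eq_zero_iff_of_nonneg (fun i _ => Complex.normSq_nonneg _)] at h1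
  apply h
  funext i
  refine Fin.cases h0 (fun j => ?_) i
  simpa using h1 j (Finset.mem_univ _)

/-- Orthogonal null vectors are proportional. -/
theorem smul_eq_smul_of_isNull {x y : V n} (hx : IsNull x) (hy : IsNull y) (hxy : herm x y = 0) :
    y 0 • x = x 0 • y := by
  have hyx : herm y x = 0 := by rw [← star_herm, hxy, star_zero]
  by_contra hne
  -- The combination is chosen to have coordinate `0` equal to zero; being null as well, it must
  -- vanish.
  have hz : IsNull (y 0 • x - x 0 • y) := by
    rw [IsNull] at *
    simp [herm_sub_left, herm_sub_right, herm_smul_left, herm_smul_right, hx, hy, hxy, hyx]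
  refine apply_zero_ne_zero_of_isNull hz (sub_ne_zero.2 hne) ?_
  simp [mul_comm]

/-- The orthogonal complement of a negative vector is positive definite. -/
theorem herm_self_pos_of_orthogonal {v w : V n} (hv : IsNeg v) (hvw : herm w v = 0) (hw : w ≠ 0) :
    0 < (herm w w).re := by
  have hv' := hv
  rw [IsNeg, herm_self_re] at hv'
  rw [herm_self_re]
  set a := ∑ i : Fin n, Complex.normSq (v i.succ) with ha
  set b := ∑ i : Fin n, Complex.normSq (w i.succ) with hb
  have ha0 : 0 ≤ a := Finset.sum_nonneg fun i _ => Complex.normSq_nonneg _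
  have hb0 : 0 ≤ b := Finset.sum_nonneg fun i _ => Complex.normSq_nonneg _
  have h1 : w 0 * star (v 0) = ∑ i : Fin n, w i.succ * star (v i.succ) := by
    rw [herm_eq_sum] at hvw
    linear_combination -hvw
  -- Cauchy–Schwarz on the positive coordinates. As `a < |v 0|²`, it will force `|w 0|² < b`.
  have h2 : Complex.normSq (w 0) * Complex.normSq (v 0) ≤ b * a := by
    have h3 : ‖w 0 * star (v 0)‖ ≤ ∑ i : Fin n, ‖w i.succ‖ * ‖v i.succ‖ := by
      rw [h1]
      refine (norm_sum_le _ _).trans (Finset.sum_le_sum fun i _ => ?_)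
      rw [norm_mul, norm_star]
    have h4 := Finset.sum_mul_sq_le_sq_mul_sq Finset.univ
      (fun i : Fin n => ‖w i.succ‖) (fun i : Fin n => ‖v i.succ‖)
    simp only [← Complex.normSq_eq_norm_sq] at h4
    calc Complex.normSq (w 0) * Complex.normSq (v 0) = ‖w 0 * star (v 0)‖ ^ 2 := by
          rw [norm_mul, norm_star, mul_pow, ← Complex.normSq_eq_norm_sq,
            ← Complex.normSq_eq_norm_sq]
      _ ≤ (∑ i : Fin n, ‖w i.succ‖ * ‖v i.succ‖) ^ 2 := by gcongr
      _ ≤ b * a := h4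
  have hb1 : 0 < b := by
    rcases hb0.lt_or_eq with h | h
    · exact h
    exfalso
    rw [← h, zero_mul] at h2
    have hw0 : Complex.normSq (w 0) = 0 := by
      by_contra hne
      have := (Complex.normSq_nonneg (w 0)).lt_of_ne' hne
      nlinarith
    apply hw
    funext i
    refine Fin.cases (by simpa using hw0) (fun j => ?_) i
    have := (Finset.sum_eq_zero_iff_of_nonneg (fun i _ => Complex.normSq_nonneg _)).1
      h.symm j (Finset.mem_univ _)
    simpa using this
  by_contra hcon
  have : b ≤ Complex.normSq (w 0) := by linarith
  nlinarith [Complex.normSq_nonneg (w 0)]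

end Herm

/-! ### Elements of `U(n,1)` and unimodular scalars. -/

section Group

variable {n : ℕ}

theorem J_mul_J (n : ℕ) : J n * J n = 1 := by
  rw [J, Matrix.diagonal_mul_diagonal, ← Matrix.diagonal_one]
  congr 1
  funext i
  split_ifs <;> simp

/-- The underlying matrix of an element of `U(n,1)`. -/
abbrev mat (A : U n) : Matrix (Fin (n + 1)) (Fin (n + 1)) ℂ := (A : GL (Fin (n + 1)) ℂ).val

theorem mat_mem (A : U n) : (mat A)ᴴ * J n * mat A = J n := A.2

theorem mat_injective : Function.Injective (mat : U n → _) := fun _ _ h =>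
  Subtype.ext (Units.ext h)

theorem mat_mul (A B : U n) : mat (A * B) = mat A * mat B := rfl

theorem lin_apply (A : U n) (x : V n) : lin A x = mat A *ᵥ x := by
  simp [lin]

theorem herm_lin (A : U n) (x y : V n) : herm (lin A x) (lin A y) = herm x y := by
  rw [lin_apply, lin_apply, herm, Matrix.star_mulVec, ← Matrix.dotProduct_mulVec,
    Matrix.mulVec_mulVec, Matrix.mulVec_mulVec, mat_mem, herm]

/-- The element of `U(n,1)` given by a matrix that preserves the form. -/
def ofMat (M : Matrix (Fin (n + 1)) (Fin (n + 1)) ℂ) (h : Mᴴ * J n * M = J n) : U n :=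
  have h1 : J n * Mᴴ * J n * M = 1 := by
    rw [mul_assoc, mul_assoc, ← mul_assoc Mᴴ, h, J_mul_J]
  ⟨⟨M, J n * Mᴴ * J n, mul_eq_one_comm.1 h1, h1⟩, h⟩

@[simp] theorem mat_ofMat (M : Matrix (Fin (n + 1)) (Fin (n + 1)) ℂ) (h : Mᴴ * J n * M = J n) :
    mat (ofMat M h) = M := rfl

/-- Multiplication by a scalar of modulus `1`. -/
def scalarU (n : ℕ) (c : ℂ) (hc : ‖c‖ = 1) : U n :=
  ofMat (c • 1) (by
    have : (starRingEnd ℂ) c * c = 1 := by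
      rw [Complex.conj_mul', hc]; simp
    simp [smul_smul, mul_comm c, this])

theorem scalarU_mem_center (c : ℂ) (hc : ‖c‖ = 1) : scalarU n c hc ∈ Subgroup.center (U n) := by
  rw [Subgroup.mem_center_iff]
  intro g
  apply mat_injective
  simp [mat_mul, scalarU]

theorem mk_scalarU_mul (c : ℂ) (hc : ‖c‖ = 1) (A : U n) :
    (QuotientGroup.mk (scalarU n c hc * A) : PU n) = QuotientGroup.mk A := by
  rw [QuotientGroup.mk_mul, (QuotientGroup.eq_one_iff _).2 (scalarU_mem_center c hc), one_mul]

theorem conj_mul_self_of_norm {c : ℂ} (hc : ‖c‖ = 1) : star c * c = 1 := by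
  rw [Complex.star_def, Complex.conj_mul', hc]; simp

end Group

/-! ### Reversible elements, and diagonal unitary matrices as products of involutions. -/

section Involutions

/-- A product of two involutions is reversible. -/
theorem mul_mem_reversibles {G : Type*} [Group G] {a b : G} (ha : a ∈ involutions G)
    (hb : b ∈ involutions G) : a * b ∈ reversibles G := by
  simp only [involutions, Set.mem_ofPred_eq, sq] at ha hb
  have ha' : a⁻¹ = a := inv_eq_of_mul_eq_one_right ha
  have hb' : b⁻¹ = b := inv_eq_of_mul_eq_one_right hb
  rw [reversibles, Set.mem_ofPred_eq, isConj_iff]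
  exact ⟨a, by rw [mul_inv_rev, ha', hb', ← mul_assoc, ha, one_mul]⟩

/-- Pad the list with `1`, itself an involution, to length four and multiply in pairs. -/
theorem IsReflectionTimes.reversibles {n k : ℕ} {T : PU n}
    (h : IsReflectionTimes k 4 (involutions (PU n)) T) :
    IsReflectionTimes k 2 (reversibles (PU n)) T := by
  obtain ⟨R, hR, l, hl, hS, rfl⟩ := h
  have h1 : (1 : PU n) ∈ involutions (PU n) := by simp [involutions]
  have key : ∀ a b c d : PU n, a ∈ involutions (PU n) → b ∈ involutions (PU n) →
      c ∈ involutions (PU n) → d ∈ involutions (PU n) →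
      IsReflectionTimes k 2 (CHyp.reversibles (PU n)) (R * (a * b * (c * d))) := by
    intro a b c d ha hb hc hd
    refine ⟨R, hR, [a * b, c * d], by simp, ?_, by simp⟩
    simp only [List.mem_cons, List.not_mem_nil, or_false]
    rintro g (rfl | rfl)
    · exact mul_mem_reversibles ha hb
    · exact mul_mem_reversibles hc hd
  rcases l with _ | ⟨a, _ | ⟨b, _ | ⟨c, _ | ⟨d, _ | ⟨e, l⟩⟩⟩⟩⟩
  · simpa using key 1 1 1 1 h1 h1 h1 h1
  · simpa using key a 1 1 1 (hS _ (by simp)) h1 h1 h1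
  · simpa using key a b 1 1 (hS _ (by simp)) (hS _ (by simp)) h1 h1
  · simpa [mul_assoc] using key a b c 1 (hS _ (by simp)) (hS _ (by simp)) (hS _ (by simp)) h1
  · simpa [mul_assoc] using
      key a b c d (hS _ (by simp)) (hS _ (by simp)) (hS _ (by simp)) (hS _ (by simp))
  · simp only [List.length_cons] at hl; omega

/-- A diagonal unitary matrix whose entries are inverted by an involution of the index set is a
product of two unitary involutions. -/
theorem diagonal_eq_mul_of_involutive {ι : Type*} [Fintype ι] [DecidableEq ι] {e : ι → ℂ}
    (he : ∀ i, ‖e i‖ = 1) (σ : ι → ι) (hσ : ∀ i, σ (σ i) = i) (h : ∀ i, e i * e (σ i) = 1) :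
    ∃ s t : Matrix ι ι ℂ, s * s = 1 ∧ t * t = 1 ∧ sᴴ * s = 1 ∧ tᴴ * t = 1 ∧
      Matrix.diagonal e = s * t := by
  -- Both factors are monomial matrices supported on the graph of `σ`: `s` has entries `e`, and `t`
  -- is the permutation matrix.
  have key : ∀ f g : ι → ℂ, (Matrix.of fun i j => if j = σ i then f i else 0) *
      (Matrix.of fun i j => if j = σ i then g i else 0) =
      Matrix.diagonal fun i => f i * g (σ i) := by
    intro f g
    ext i j
    rw [Matrix.mul_apply, Finset.sum_eq_single (σ i)]
    · simp [Matrix.diagonal_apply, hσ, eq_comm]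
    · intro k _ hk
      simp [hk]
    · simp
  -- For unimodular `f`, the relation `f i * f (σ i) = 1` says that `f (σ i)` is the conjugate of `f
  -- i`, so the monomial matrix is Hermitian; an involution that is Hermitian is unitary.
  have hstar : ∀ f : ι → ℂ, (∀ i, ‖f i‖ = 1) → (∀ i, f i * f (σ i) = 1) →
      (Matrix.of fun i j => if j = σ i then f i else 0)ᴴ =
        Matrix.of fun i j => if j = σ i then f i else 0 := by
    intro f hf hfσ
    ext i j
    simp only [Matrix.conjTranspose_apply, Matrix.of_apply]
    by_cases hij : i = σ j
    · subst hij
      rw [if_pos rfl, if_pos (hσ j).symm]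
      have h1 := conj_mul_self_of_norm (hf j)
      have h2 := hfσ j
      have h3 : f j ≠ 0 := by rintro h3; simp [h3] at h2
      apply mul_right_cancel₀ h3
      rw [h1, mul_comm, h2]
    · rw [if_neg hij, if_neg (fun h' => hij (by rw [h', hσ])), star_zero]
  have hs := key e e
  simp only [h, Matrix.diagonal_one] at hs
  have ht := key 1 1
  simp only [Pi.one_apply, mul_one, Matrix.diagonal_one] at ht
  refine ⟨_, _, hs, ht, ?_, ?_, ?_⟩
  · rw [hstar e he h, hs]
  · have := hstar 1 (by simp) (by simp)
    simp only [Pi.one_apply] at this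
    rw [this, ht]
  · have := key e 1
    simpa using this.symm

/-- A diagonal unitary matrix of determinant `±1` is a product of four unitary involutions. -/
theorem diagonal_eq_mul_four {m : ℕ} {b : Fin m → ℂ} (hb : ∀ i, ‖b i‖ = 1)
    (hprod : (∏ i, b i) * (∏ i, b i) = 1) :
    ∃ s : Fin 4 → Matrix (Fin m) (Fin m) ℂ, (∀ i, s i * s i = 1) ∧ (∀ i, (s i)ᴴ * s i = 1) ∧
      Matrix.diagonal b = s 0 * s 1 * s 2 * s 3 := by
  set B : ℕ → ℂ := fun k => if h : k < m then b ⟨k, h⟩ else 1 with hB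
  set P : ℕ → ℂ := fun k => ∏ j ∈ Finset.range k, B j with hP
  have hBn : ∀ k, ‖B k‖ = 1 := by
    intro k; simp only [hB]; split_ifs <;> simp [hb]
  have hPn : ∀ k, ‖P k‖ = 1 := by
    intro k; simp [hP, norm_prod, hBn]
  have hP0 : ∀ k, P k ≠ 0 := fun k h => by simpa [h] using hPn k
  have hPm : P m * P m = 1 := by
    have : P m = ∏ i, b i := by
      simp only [hP]
      rw [Finset.prod_range]
      exact Finset.prod_congr rfl fun i _ => by simp [hB]
    rw [this, hprod]
  have hPs : ∀ i : Fin m, P (i + 1) = P i * b i := by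
    intro i
    simp only [hP, Finset.prod_range_succ]
    simp [hB]
  have hPinv : ∀ k, (P k)⁻¹ * P k = 1 := fun k => inv_mul_cancel₀ (hP0 k)
  have hPinv' : ∀ k, P k * (P k)⁻¹ = 1 := fun k => mul_inv_cancel₀ (hP0 k)
  -- With partial products `P`, `b i = P (i + 1) / P i` splits into two diagonals. In this one the
  -- indices `2j` and `2j + 1` carry `P (2j + 1)` and its inverse; an unpaired last index carries `P
  -- m = ±1`.
  obtain ⟨s, t, h1, h2, h3, h4, h5⟩ := diagonal_eq_mul_of_involutive
    (e := fun i : Fin m => if (i : ℕ) % 2 = 0 then P (i + 1) else (P i)⁻¹)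
    (by intro i; split_ifs <;> simp [hPn])
    (fun i => if h : (i : ℕ) % 2 = 0 then
      if h' : (i : ℕ) + 1 < m then ⟨i + 1, h'⟩ else i else ⟨i - 1, by omega⟩)
    (by rintro ⟨i, hi⟩; apply Fin.ext; dsimp only; split_ifs <;> simp_all <;> omega)
    (by
      rintro ⟨i, hi⟩
      dsimp only
      by_cases h : i % 2 = 0
      · by_cases h' : i + 1 < m
        · have : (i + 1) % 2 ≠ 0 := by omega
          simp [h, h', this, hPinv']
        · have : i + 1 = m := by omega
          simp [h, this, hPm]
      · have h1 : (i - 1) % 2 = 0 := by omega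
        have h2 : i - 1 + 1 = i := by omega
        simp [h, h1, h2, hPinv])
  -- Shifted pairing: `2j - 1` and `2j` carry `P (2j)` and its inverse. Index `0` is fixed, since `0
  -- - 1 = 0` in `ℕ`, and carries `P 0 = 1`; an unpaired last index again carries `P m`.
  obtain ⟨s', t', h1', h2', h3', h4', h5'⟩ := diagonal_eq_mul_of_involutive
    (e := fun i : Fin m => if (i : ℕ) % 2 = 0 then (P i)⁻¹ else P (i + 1))
    (by intro i; split_ifs <;> simp [hPn])
    (fun i => if h : (i : ℕ) % 2 = 0 then ⟨i - 1, by omega⟩ else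
      if h' : (i : ℕ) + 1 < m then ⟨i + 1, h'⟩ else i)
    (by
      rintro ⟨i, hi⟩
      apply Fin.ext
      dsimp only
      by_cases h : i % 2 = 0
      · by_cases h0 : i = 0
        · subst h0; simp
        · have h1 : (i - 1) % 2 ≠ 0 := by omega
          have h2 : i - 1 + 1 = i := by omega
          simp [h, h1, h2, hi]
      · by_cases h' : i + 1 < m
        · have : (i + 1) % 2 = 0 := by omega
          simp [h, h', this]
        · simp [h, h'])
    (by
      rintro ⟨i, hi⟩
      dsimp only
      by_cases h : i % 2 = 0
      · by_cases h0 : i = 0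
        · subst h0; simp [hP]
        · have h1 : (i - 1) % 2 ≠ 0 := by omega
          have h2 : i - 1 + 1 = i := by omega
          simp [h, h1, h2, hPinv]
      · by_cases h' : i + 1 < m
        · have : (i + 1) % 2 = 0 := by omega
          simp [h, h', this, hPinv']
        · have : i + 1 = m := by omega
          simp [h, this, hPm])
  refine ⟨![s, t, s', t'], ?_, ?_, ?_⟩
  · intro i; fin_cases i <;> simp [h1, h2, h1', h2']
  · intro i; fin_cases i <;> simp [h3, h4, h3', h4']
  · simp only [Matrix.cons_val]
    rw [← h5, mul_assoc, ← h5', Matrix.diagonal_mul_diagonal]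
    congr 1
    funext i
    have := hPs i
    split_ifs <;> rw [this] <;> field_simp [hP0]

/-- Allowing the product to be `-1` as well as `1` leaves room to avoid `c * μ = 1`: an `m`-th root
`c` of the inverse product can be replaced by `c * z` with `z ^ m = -1`, and `z ≠ 1`. -/
theorem exists_scalar {m : ℕ} {b : Fin m → ℂ} (hb : ∀ i, ‖b i‖ = 1) (μ : ℂ) :
    ∃ c : ℂ, ‖c‖ = 1 ∧ c * μ ≠ 1 ∧ (∏ i, c * b i) * (∏ i, c * b i) = 1 := by
  simp only [Finset.prod_mul_distrib, Finset.prod_const, Finset.card_univ, Fintype.card_fin]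
  have hB : ‖∏ i, b i‖ = 1 := by simp [norm_prod, hb]
  set β := ∏ i, b i with hβ
  have hβ0 : β ≠ 0 := fun h => by simp [h] at hB
  rcases Nat.eq_zero_or_pos m with rfl | hm
  · have : β = 1 := by simp [hβ]
    by_cases h : μ = 1
    · exact ⟨-1, by simp, by rw [h]; norm_num, by simp [this]⟩
    · exact ⟨1, by simp, by simpa using h, by simp [this]⟩
  obtain ⟨c, hc⟩ := IsAlgClosed.exists_pow_nat_eq β⁻¹ hm
  obtain ⟨z, hz⟩ := IsAlgClosed.exists_pow_nat_eq (-1 : ℂ) hm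
  have hn : ∀ w : ℂ, ‖w ^ m‖ = 1 → ‖w‖ = 1 := fun w hw => by
    rw [norm_pow] at hw
    exact (pow_eq_one_iff_of_nonneg (norm_nonneg _) hm.ne').1 hw
  have hcn : ‖c‖ = 1 := hn c (by rw [hc, norm_inv, hB, inv_one])
  have hzn : ‖z‖ = 1 := hn z (by rw [hz]; simp)
  have hz1 : z ≠ 1 := by
    rintro rfl
    rw [one_pow] at hz
    norm_num at hz
  by_cases h : c * μ = 1
  · refine ⟨c * z, by simp [hcn, hzn], fun h' => hz1 ?_, ?_⟩
    · calc z = (c * μ) * z := by rw [h, one_mul]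
        _ = c * z * μ := by ring
        _ = 1 := h'
    · rw [mul_pow, hc, hz]; field_simp
  · exact ⟨c, hcn, h, by rw [hc]; field_simp⟩

end Involutions

/-! ### Gluing a block on `P` to a diagonal block on its complement. -/

section Blocks

variable {n d m : ℕ}

/-- `S` is a frame with Gram matrix `G`: a matrix preserving `G` becomes an isometry of `J n` when
written in standard coordinates. -/
theorem conj_preserves_J {ι : Type*} [Fintype ι] [DecidableEq ι]
    {S : Matrix (Fin (n + 1)) ι ℂ} {S' : Matrix ι (Fin (n + 1)) ℂ}
    (h1 : S * S' = 1) {G M : Matrix ι ι ℂ} (hS : Sᴴ * J n * S = G) (hM : Mᴴ * G * M = G) :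
    (S * M * S')ᴴ * J n * (S * M * S') = J n := by
  calc (S * M * S')ᴴ * J n * (S * M * S')
      = S'ᴴ * (Mᴴ * (Sᴴ * J n * S) * M) * S' := by
        simp only [Matrix.conjTranspose_mul, Matrix.mul_assoc]
    _ = (S * S')ᴴ * J n * (S * S') := by
        rw [hS, hM, ← hS]
        simp only [Matrix.conjTranspose_mul, Matrix.mul_assoc]
    _ = J n := by simp [h1]

theorem conj_mul_conj {ι κ : Type*} [Fintype ι] [DecidableEq ι] [Fintype κ]
    {S : Matrix κ ι ℂ} {S' : Matrix ι κ ℂ}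
    (h2 : S' * S = 1) (M N : Matrix ι ι ℂ) :
    (S * M * S') * (S * N * S') = S * (M * N) * S' := by
  calc (S * M * S') * (S * N * S') = S * M * (S' * S) * N * S' := by
        simp only [Matrix.mul_assoc]
    _ = S * (M * N) * S' := by simp [h2, Matrix.mul_assoc]

/-- Since `ν ≠ 1`, the eigenspaces for `ν` and `1` are exactly the column spaces of the two blocks
of `S`, of dimensions `d` and `m`. -/
theorem isReflection_of_blocks (hd : d + m = n + 1)
    {R : U n} {S : Matrix (Fin (n + 1)) (Fin d ⊕ Fin m) ℂ}
    {S' : Matrix (Fin d ⊕ Fin m) (Fin (n + 1)) ℂ} (h1 : S * S' = 1) (h2 : S' * S = 1)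
    {ν : ℂ} (hν : ν ≠ 1)
    (hR : mat R = S * Matrix.fromBlocks (ν • (1 : Matrix (Fin d) (Fin d) ℂ)) 0 0
      (1 : Matrix (Fin m) (Fin m) ℂ) * S')
    (v : Fin d → ℂ) (hv : IsNeg (S *ᵥ Sum.elim v 0)) : IsReflection (d - 1) R := by
  have hSR : ∀ y z, lin R (S *ᵥ Sum.elim y z) = S *ᵥ Sum.elim (ν • y) z := by
    intro y z
    rw [lin_apply, hR, Matrix.mulVec_mulVec, Matrix.mul_assoc, h2, Matrix.mul_one,
      ← Matrix.mulVec_mulVec, Matrix.fromBlocks_mulVec]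
    simp [Matrix.smul_mulVec]
  have hS_inj : Function.Injective (S *ᵥ ·) := fun x y h => by
    have := congrArg (S' *ᵥ ·) h
    simpa [Matrix.mulVec_mulVec, h2] using this
  have hS_surj : ∀ x, ∃ y z, x = S *ᵥ Sum.elim y z := fun x =>
    ⟨_, _, by rw [Sum.elim_comp_inl_inr (S' *ᵥ x), Matrix.mulVec_mulVec, h1, Matrix.one_mulVec]⟩
  have key : ∀ (y : Fin d → ℂ) (z : Fin m → ℂ) (y' : Fin d → ℂ) (z' : Fin m → ℂ),
      S *ᵥ Sum.elim y z = S *ᵥ Sum.elim y' z' ↔ y = y' ∧ z = z' := by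
    intro y z y' z'
    rw [hS_inj.eq_iff, Sum.elim_eq_iff]
  have hcols : S = Matrix.fromCols S.toCols₁ S.toCols₂ := (Matrix.fromCols_toCols S).symm
  have hleft : ∀ y, S.toCols₁ *ᵥ y = S *ᵥ Sum.elim y 0 := by
    intro y
    conv_rhs => rw [hcols, Matrix.fromCols_mulVec]
    simp
  have hright : ∀ z, S.toCols₂ *ᵥ z = S *ᵥ Sum.elim 0 z := by
    intro z
    conv_rhs => rw [hcols, Matrix.fromCols_mulVec]
    simp
  have hsmul : ∀ (c : ℂ) (y : Fin d → ℂ) (z : Fin m → ℂ),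
      c • (S *ᵥ Sum.elim y z) = S *ᵥ Sum.elim (c • y) (c • z) := by
    intro c y z
    rw [← Matrix.mulVec_smul]
    congr 1
    funext i
    cases i <;> simp
  have hE1 : Module.End.eigenspace (lin R) ν = LinearMap.range S.toCols₁.mulVecLin := by
    ext x
    obtain ⟨y, z, rfl⟩ := hS_surj x
    rw [Module.End.mem_eigenspace_iff, hSR, hsmul, key, LinearMap.mem_range]
    simp only [Matrix.mulVecLin_apply, hleft, key]
    constructor
    · rintro ⟨-, h⟩
      refine ⟨y, rfl, ?_⟩
      funext i
      have hi := congrFun h i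
      simp only [Pi.smul_apply, smul_eq_mul] at hi
      have : (1 - ν) * z i = 0 := by linear_combination hi
      rcases mul_eq_zero.1 this with h' | h'
      · exact absurd (sub_eq_zero.1 h').symm hν
      · exact h'.symm
    · rintro ⟨y', rfl, rfl⟩
      simp
  have hE2 : Module.End.eigenspace (lin R) 1 = LinearMap.range S.toCols₂.mulVecLin := by
    ext x
    obtain ⟨y, z, rfl⟩ := hS_surj x
    rw [Module.End.mem_eigenspace_iff, hSR, hsmul, key, LinearMap.mem_range]
    simp only [Matrix.mulVecLin_apply, hright, key]
    constructor
    · rintro ⟨h, -⟩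
      refine ⟨z, ?_, rfl⟩
      funext i
      have hi := congrFun h i
      simp only [Pi.smul_apply, smul_eq_mul] at hi
      have : (ν - 1) * y i = 0 := by linear_combination hi
      rcases mul_eq_zero.1 this with h' | h'
      · exact absurd (sub_eq_zero.1 h') hν
      · exact h'.symm
    · rintro ⟨z', rfl, rfl⟩
      simp
  have hr1 : Module.finrank ℂ (Module.End.eigenspace (lin R) ν) = d := by
    rw [hE1, LinearMap.finrank_range_of_inj]
    · simp
    · intro y y' h
      simp only [Matrix.mulVecLin_apply, hleft, key] at h
      exact h.1
  have hr2 : Module.finrank ℂ (Module.End.eigenspace (lin R) 1) = m := by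
    rw [hE2, LinearMap.finrank_range_of_inj]
    · simp
    · intro y y' h
      simp only [Matrix.mulVecLin_apply, hright, key] at h
      exact h.2
  -- The negative vector excludes `d = 0`, so the truncated subtraction satisfies `d - 1 + 1 = d`.
  have hd0 : 0 < d := by
    rcases Nat.eq_zero_or_pos d with rfl | h
    · exfalso
      have : (Sum.elim v 0 : Fin 0 ⊕ Fin m → ℂ) = 0 := by
        funext i
        rcases i with i | i
        · exact i.elim0
        · rfl
      rw [this, Matrix.mulVec_zero] at hv
      simp [IsNeg] at hv
    · exact h
  refine ⟨ν, hν, ⟨_, ?_, hv⟩, by rw [hr1]; omega, by rw [hr2]; omega⟩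
  rw [Module.End.mem_eigenspace_iff, hSR, hsmul, smul_zero]

/-- After rescaling by the `c` of `exists_scalar`, the scalar `c * μ` goes into the reflection, and
the four involutions of each block are paired up as `a i ⊕ s i`. -/
theorem isReflectionTimes_of_blocks (hd : d + m = n + 1)
    {A : U n} {S : Matrix (Fin (n + 1)) (Fin d ⊕ Fin m) ℂ}
    {S' : Matrix (Fin d ⊕ Fin m) (Fin (n + 1)) ℂ} (h1 : S * S' = 1) (h2 : S' * S = 1)
    {G : Matrix (Fin d) (Fin d) ℂ} (hS : Sᴴ * J n * S = Matrix.fromBlocks G 0 0 1)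
    {a : Fin 4 → Matrix (Fin d) (Fin d) ℂ} (ha : ∀ i, a i * a i = 1)
    (haG : ∀ i, (a i)ᴴ * G * a i = G) {μ : ℂ} (hμ : ‖μ‖ = 1) {b : Fin m → ℂ}
    (hb : ∀ i, ‖b i‖ = 1)
    (hA : mat A * S = S * Matrix.fromBlocks (μ • (a 0 * a 1 * a 2 * a 3)) 0 0 (Matrix.diagonal b))
    {v : Fin d → ℂ} (hv : IsNeg (S *ᵥ Sum.elim v 0)) :
    IsReflectionTimes (d - 1) 4 (involutions (PU n)) (QuotientGroup.mk A) := by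
  obtain ⟨c, hc, hcμ, hprod⟩ := exists_scalar hb μ
  obtain ⟨s, hs, hs', hdiag⟩ := diagonal_eq_mul_four (b := fun i => c * b i)
    (fun i => by simp [hc, hb]) hprod
  have hcμ' : star (c * μ) * (c * μ) = 1 := conj_mul_self_of_norm (by simp [hc, hμ])
  have hRG : (Matrix.fromBlocks ((c * μ) • (1 : Matrix (Fin d) (Fin d) ℂ)) 0 0
      (1 : Matrix (Fin m) (Fin m) ℂ))ᴴ * Matrix.fromBlocks G 0 0 1 *
      Matrix.fromBlocks ((c * μ) • 1) 0 0 1 = Matrix.fromBlocks G 0 0 1 := by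
    simp only [Matrix.fromBlocks_conjTranspose, Matrix.fromBlocks_multiply]
    simp only [Matrix.conjTranspose_smul, Matrix.conjTranspose_one, Matrix.conjTranspose_zero,
      Matrix.smul_mul, Matrix.mul_smul, Matrix.one_mul, Matrix.mul_one, Matrix.mul_zero,
      Matrix.zero_mul, add_zero, zero_add, smul_smul, smul_zero]
    rw [mul_comm, hcμ', one_smul]
  have hIG : ∀ i, (Matrix.fromBlocks (a i) 0 0 (s i))ᴴ * Matrix.fromBlocks G 0 0 1 *
      Matrix.fromBlocks (a i) 0 0 (s i) = Matrix.fromBlocks G 0 0 1 := by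
    intro i
    simp [Matrix.fromBlocks_conjTranspose, Matrix.fromBlocks_multiply, haG, hs']
  set R : U n := ofMat _ (conj_preserves_J h1 hS hRG) with hR
  set I : Fin 4 → U n := fun i => ofMat _ (conj_preserves_J h1 hS (hIG i)) with hI
  have hII : ∀ i, I i * I i = 1 := by
    intro i
    apply mat_injective
    rw [mat_mul, hI, mat_ofMat, conj_mul_conj h2, Matrix.fromBlocks_multiply]
    simp only [ha, hs, Matrix.mul_zero, Matrix.zero_mul, add_zero, zero_add,
      Matrix.fromBlocks_one, Matrix.mul_one, h1]
    rfl
  refine ⟨QuotientGroup.mk R, ⟨R, rfl, isReflection_of_blocks hd h1 h2 hcμ rfl v hv⟩,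
    [QuotientGroup.mk (I 0), QuotientGroup.mk (I 1), QuotientGroup.mk (I 2),
      QuotientGroup.mk (I 3)], by simp, ?_, ?_⟩
  · have : ∀ i, (QuotientGroup.mk (I i) : PU n) ∈ involutions (PU n) := by
      intro i
      rw [involutions, Set.mem_ofPred_eq, sq, ← QuotientGroup.mk_mul, hII, QuotientGroup.mk_one]
    simp only [List.mem_cons, List.not_mem_nil, or_false]
    rintro g (rfl | rfl | rfl | rfl) <;> exact this _
  · rw [← mk_scalarU_mul c hc A]
    simp only [List.prod_cons, List.prod_nil, mul_one, ← QuotientGroup.mk_mul]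
    congr 1
    apply mat_injective
    simp only [mat_mul, hR, hI, mat_ofMat, conj_mul_conj h2, scalarU]
    have hA' : mat A = S * Matrix.fromBlocks (μ • (a 0 * a 1 * a 2 * a 3)) 0 0
        (Matrix.diagonal b) * S' := by
      rw [← hA, Matrix.mul_assoc, h1, Matrix.mul_one]
    have hdiag' : s 0 * (s 1 * (s 2 * s 3)) = c • Matrix.diagonal b := by
      rw [← mul_assoc, ← mul_assoc, ← hdiag, ← Matrix.diagonal_smul]
      rfl
    simp only [Matrix.fromBlocks_multiply, Matrix.mul_zero, Matrix.zero_mul, add_zero, zero_add,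
      Matrix.one_mul, Matrix.smul_mul, hdiag', hA']
    rw [← Matrix.smul_mul, ← Matrix.mul_smul, Matrix.fromBlocks_smul]
    simp [smul_smul, Matrix.mul_assoc]

end Blocks

/-! ### The spectral theorem on positive definite invariant subspaces. -/

section Diagonalization

variable {n : ℕ}

/-- An invariant positive definite subspace has an orthonormal basis of eigenvectors. -/
theorem exists_orthonormal_eigenvectors (A : U n) :
    ∀ (m : ℕ) (W : Submodule ℂ (V n)), Module.finrank ℂ W = m → (∀ x ∈ W, lin A x ∈ W) →
      (∀ x ∈ W, x ≠ 0 → 0 < (herm x x).re) →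
      ∃ (w : Fin m → V n) (b : Fin m → ℂ), (∀ i, w i ∈ W) ∧
        (∀ i j, herm (w i) (w j) = if i = j then 1 else 0) ∧ ∀ i, lin A (w i) = b i • w i := by
  intro m
  induction m with
  | zero => intro W _ _ _; exact ⟨Fin.elim0, Fin.elim0, fun i => i.elim0, fun i => i.elim0,
      fun i => i.elim0⟩
  | succ m ih =>
    intro W hW hAW hpos
    have : Nontrivial W := Module.nontrivial_of_finrank_pos (R := ℂ) (by omega)
    obtain ⟨β, hβ⟩ := Module.End.exists_eigenvalue ((lin A).restrict hAW)
    obtain ⟨x, hx⟩ := hβ.exists_hasEigenvector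
    have hx0 : (x : V n) ≠ 0 := fun h => hx.2 (Subtype.ext h)
    have hAx : lin A (x : V n) = β • (x : V n) := congrArg Subtype.val hx.apply_eq_smul
    have hxpos := hpos _ x.2 hx0
    set r : ℝ := Real.sqrt (herm (x : V n) x).re with hr
    have hr0 : r ≠ 0 := (Real.sqrt_pos.2 hxpos).ne'
    set e : V n := ((r : ℂ)⁻¹) • (x : V n) with he
    have heW : e ∈ W := W.smul_mem _ x.2
    have hee : herm e e = 1 := by
      rw [he, herm_smul_left, herm_smul_right, herm_self_eq]
      have : ((herm (x : V n) x).re : ℂ) = (r : ℂ) * r := by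
        rw [← Complex.ofReal_mul, hr, Real.mul_self_sqrt hxpos.le]
      rw [this]
      have hrc : (r : ℂ) ≠ 0 := by exact_mod_cast hr0
      simp
      field_simp
    have hAe : lin A e = β • e := by rw [he, map_smul, hAx, smul_comm]
    have hβ1 : star β * β = 1 := by
      have := herm_lin A e e
      rw [hAe, herm_smul_left, herm_smul_right, hee] at this
      linear_combination this
    have hβ0 : β ≠ 0 := by rintro rfl; simp at hβ1
    set φ : W →ₗ[ℂ] ℂ := (hermFunctional e).domRestrict W with hφ
    have hφe : φ ⟨e, heW⟩ = 1 := hee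
    have hφs : LinearMap.range φ = ⊤ := by
      rw [LinearMap.range_eq_top]
      intro c
      exact ⟨c • ⟨e, heW⟩, by rw [map_smul, hφe, smul_eq_mul, mul_one]⟩
    have hker : Module.finrank ℂ (LinearMap.ker φ) = m := by
      have := LinearMap.finrank_range_add_finrank_ker φ
      rw [hφs, finrank_top, Module.finrank_self, hW] at this
      omega
    have hmem : ∀ y, y ∈ (LinearMap.ker φ).map W.subtype ↔ y ∈ W ∧ herm y e = 0 := by
      intro y
      simp only [Submodule.mem_map, LinearMap.mem_ker, Submodule.subtype_apply]
      constructor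
      · rintro ⟨z, hz, rfl⟩; exact ⟨z.2, hz⟩
      · rintro ⟨h, h'⟩; exact ⟨⟨y, h⟩, h', rfl⟩
    -- Recurse on the complement of `e` in `W`. It is invariant because `e` is an eigenvector with
    -- non-zero eigenvalue.
    obtain ⟨w, b, hw1, hw2, hw3⟩ := ih ((LinearMap.ker φ).map W.subtype)
      (by rw [Submodule.finrank_map_subtype_eq]; exact hker)
      (by
        intro y hy
        rw [hmem] at hy ⊢
        refine ⟨hAW y hy.1, ?_⟩
        have := herm_lin A y e
        rw [hAe, herm_smul_right, hy.2] at this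
        exact (mul_eq_zero.1 this).resolve_left (by simpa using hβ0))
      (fun y hy => hpos y ((hmem y).1 hy).1)
    simp only [hmem] at hw1
    have hew : ∀ i, herm e (w i) = 0 := fun i => by rw [← star_herm, (hw1 i).2, star_zero]
    refine ⟨Fin.cons e w, Fin.cons β b, ?_, ?_, ?_⟩
    · intro i; refine Fin.cases heW (fun j => (hw1 j).1) i
    · intro i j
      refine Fin.cases ?_ (fun i => ?_) i <;> refine Fin.cases ?_ (fun j => ?_) j
      · simp [hee]
      · simp [hew, (Fin.succ_ne_zero j).symm]
      · simp [(hw1 i).2]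
      · simp [hw2]
    · intro i; refine Fin.cases ?_ (fun j => ?_) i
      · simpa using hAe
      · simpa using hw3 j

end Diagonalization

/-! ### From the action on an invariant span to the factorization. -/

section Families

variable {n d : ℕ}

/-- An isometry `A` that acts on the span of `p` as a scalar times a product of four isometric
involutions, the span containing a negative vector. -/
theorem isReflectionTimes_of_family {A : U n} {p : Fin d → V n} {G : Matrix (Fin d) (Fin d) ℂ}
    (hG : ∀ i j, herm (p j) (p i) = G i j) (hdet : IsUnit G)
    {a : Fin 4 → Matrix (Fin d) (Fin d) ℂ} (ha : ∀ i, a i * a i = 1)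
    (haG : ∀ i, (a i)ᴴ * G * a i = G) {μ : ℂ} (hμ : ‖μ‖ = 1)
    (hA : ∀ j, lin A (p j) = ∑ i, (μ • (a 0 * a 1 * a 2 * a 3)) i j • p i)
    {v : Fin d → ℂ} (hv : IsNeg (∑ i, v i • p i)) :
    IsReflectionTimes (d - 1) 4 (involutions (PU n)) (QuotientGroup.mk A) := by
  set D := μ • (a 0 * a 1 * a 2 * a 3) with hD
  have hμ0 : μ ≠ 0 := by rintro rfl; simp at hμ
  have hau : ∀ i, IsUnit (a i) := fun i => IsUnit.of_mul_eq_one _ (ha i)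
  have hDu : IsUnit D := by
    rw [hD, ← Units.smul_mk0 hμ0]
    exact ((((hau 0).mul (hau 1)).mul (hau 2)).mul (hau 3)).smul _
  have hGinv : G⁻¹ * G = 1 := Matrix.nonsing_inv_mul _ ((Matrix.isUnit_iff_isUnit_det _).1 hdet)
  have hGinv' : G * G⁻¹ = 1 := Matrix.mul_nonsing_inv _ ((Matrix.isUnit_iff_isUnit_det _).1 hdet)
  -- The kernel of `Φ` is the orthogonal complement of the span of `p`. Invertibility of the Gram
  -- matrix makes `Φ` onto, which gives the dimension of the kernel.
  set Φ : V n →ₗ[ℂ] (Fin d → ℂ) := LinearMap.pi fun i => hermFunctional (p i) with hΦ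
  have hΦs : LinearMap.range Φ = ⊤ := by
    rw [LinearMap.range_eq_top]
    intro y
    refine ⟨∑ j, (G⁻¹ *ᵥ y) j • p j, ?_⟩
    funext i
    have h1 : Φ (∑ j, (G⁻¹ *ᵥ y) j • p j) i = (G *ᵥ (G⁻¹ *ᵥ y)) i := by
      simp only [hΦ, LinearMap.pi_apply, hermFunctional_apply, herm_sum_left, herm_smul_left, hG]
      simp [Matrix.mulVec, dotProduct, mul_comm]
    rw [h1, Matrix.mulVec_mulVec, hGinv', Matrix.one_mulVec]
  have hfin := LinearMap.finrank_range_add_finrank_ker Φ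
  rw [hΦs, finrank_top] at hfin
  simp only [Module.finrank_fintype_fun_eq_card, Fintype.card_fin] at hfin
  set W := LinearMap.ker Φ with hW
  have hmem : ∀ x, x ∈ W ↔ ∀ i, herm x (p i) = 0 := by
    intro x
    rw [hW, LinearMap.mem_ker, funext_iff]
    rfl
  obtain ⟨w, b, hw1, hw2, hw3⟩ := exists_orthonormal_eigenvectors A _ W rfl
    (by
      intro x hx
      rw [hmem] at hx ⊢
      -- `A x` is orthogonal to every `A (p j)`; as `D` is invertible, these span the same space as
      -- the `p i`.
      have h1 : Dᴴ *ᵥ (fun i => herm (lin A x) (p i)) = 0 := by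
        funext j
        have h2 := herm_lin A x (p j)
        rw [hA, hx, herm_sum_right] at h2
        simpa [Matrix.mulVec, dotProduct, herm_smul_right] using h2
      have h3 : IsUnit Dᴴ := hDu.star
      have h4 : (fun i => herm (lin A x) (p i)) = 0 :=
        (Matrix.mulVec_injective_iff_isUnit.2 h3) (by rw [h1, Matrix.mulVec_zero])
      exact fun i => congrFun h4 i)
    (by
      intro x hx hx0
      refine herm_self_pos_of_orthogonal hv ?_ hx0
      rw [herm_sum_right]
      exact Finset.sum_eq_zero fun i _ => by rw [herm_smul_right, (hmem x).1 hx, mul_zero])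
  have hb : ∀ i, ‖b i‖ = 1 := by
    intro i
    have h1 := herm_lin A (w i) (w i)
    rw [hw3, herm_smul_left, herm_smul_right, hw2, if_pos rfl, mul_one, Complex.star_def,
      Complex.mul_conj'] at h1
    have h2 : ‖b i‖ ^ 2 = 1 := by exact_mod_cast h1
    exact (pow_eq_one_iff_of_nonneg (norm_nonneg _) two_ne_zero).1 h2
  set S : Matrix (Fin (n + 1)) (Fin d ⊕ Fin (Module.finrank ℂ W)) ℂ :=
    Matrix.of fun k i => Sum.elim p w i k with hS
  have hSv : ∀ y, S *ᵥ y = ∑ i, y i • Sum.elim p w i := by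
    intro y
    funext k
    simp [hS, Matrix.mulVec, dotProduct, mul_comm]
  have hgram : ∀ i j, (Sᴴ * J n * S) i j = herm (Sum.elim p w j) (Sum.elim p w i) := by
    intro i j
    rw [Matrix.mul_assoc]
    rfl
  have hSJ : Sᴴ * J n * S = Matrix.fromBlocks G 0 0 1 := by
    ext i j
    rw [hgram]
    rcases i with i | i <;> rcases j with j | j
    · simp [hG]
    · simp [(hmem _).1 (hw1 j)]
    · rw [← star_herm]
      simp [(hmem _).1 (hw1 i)]
    · simp [hw2, Matrix.one_apply, eq_comm]
  -- `H` is the inverse Gram matrix of the full frame, so `H Sᴴ J` is a left inverse of `S`; the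
  -- equality of cardinalities makes it two-sided.
  set H : Matrix (Fin d ⊕ Fin (Module.finrank ℂ W)) (Fin d ⊕ Fin (Module.finrank ℂ W)) ℂ :=
    Matrix.fromBlocks G⁻¹ 0 0 1 with hH
  have h2 : (H * (Sᴴ * J n)) * S = 1 := by
    rw [hH, Matrix.mul_assoc, hSJ, Matrix.fromBlocks_multiply]
    simp [hGinv]
  have h1 : S * (H * (Sᴴ * J n)) = 1 :=
    (Matrix.mul_eq_one_comm_of_equiv
      (Fintype.equivOfCardEq (by simpa using hfin.symm))).2 h2
  refine isReflectionTimes_of_blocks (by simpa using hfin) h1 h2 hSJ ha haG hμ hb ?_ (v := v) ?_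
  · refine Matrix.ext_of_mulVec_single fun i => ?_
    rw [← Matrix.mulVec_mulVec, ← Matrix.mulVec_mulVec, hSv (Pi.single i 1), hSv]
    rw [← lin_apply, map_sum]
    simp only [map_smul]
    rw [Finset.sum_eq_single i (by intro j _ hj; simp [hj]) (by simp)]
    rw [Fintype.sum_sum_type]
    rcases i with i | i
    · simp [hA, hD]
    · simp [hw3, Matrix.diagonal_apply]
  · rw [hSv]
    simpa using hv

end Families

/-! ### The four model blocks. -/

section NormalForms

variable {n : ℕ}

theorem norm_eq_one_of_isNeg {A : U n} {v : V n} {μ : ℂ} (hv : IsNeg v)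
    (hA : lin A v = μ • v) : ‖μ‖ = 1 := by
  have h1 := herm_lin A v v
  have h0 : herm v v ≠ 0 := by
    intro h
    simp [IsNeg, h] at hv
  rw [hA, herm_smul_left, herm_smul_right, ← mul_assoc, Complex.star_def,
    Complex.mul_conj'] at h1
  have h2 : ((‖μ‖ : ℂ)) ^ 2 = 1 := mul_right_cancel₀ h0 (by rw [h1, one_mul])
  have h3 : ‖μ‖ ^ 2 = 1 := by exact_mod_cast h2
  exact (pow_eq_one_iff_of_nonneg (norm_nonneg _) two_ne_zero).1 h3

theorem isReflectionTimes_of_negative_eigenvector {A : U n} {v : V n} {μ : ℂ} (hv : IsNeg v)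
    (hA : lin A v = μ • v) :
    IsReflectionTimes 0 4 (involutions (PU n)) (QuotientGroup.mk A) := by
  have h0 : herm v v ≠ 0 := by
    intro h
    simp [IsNeg, h] at hv
  refine isReflectionTimes_of_family (p := ![v]) (G := !![herm v v]) (a := fun _ => 1)
    (v := ![1]) (μ := μ) ?_ ?_ (by simp) (by simp) (norm_eq_one_of_isNeg hv hA) ?_ ?_
  · intro i j; fin_cases i; fin_cases j; rfl
  · rw [Matrix.isUnit_iff_isUnit_det]; simpa using h0
  · intro j; fin_cases j; simpa using hA
  · simpa using hv

/-- Isometry forces `α * star β = 1`, so with `r = |α|` the block is the unimodular scalar `α / r`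
times `diag(r, r⁻¹)`, a product of two antidiagonal involutions of the hyperbolic plane. -/
theorem isReflectionTimes_of_null_eigenvectors {A : U n} {p q : V n} {α β : ℂ} (hp : IsNull p)
    (hq : IsNull q) (hpq : herm p q ≠ 0) (hAp : lin A p = α • p) (hAq : lin A q = β • q) :
    IsReflectionTimes 1 4 (involutions (PU n)) (QuotientGroup.mk A) := by
  rw [IsNull] at hp hq
  wlog h1 : herm p q = 1 generalizing p
  · refine this (p := (herm p q)⁻¹ • p) ?_ ?_ ?_ ?_
    · simp [herm_smul_left, herm_smul_right, hp]
    · simp [herm_smul_left, hpq]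
    · rw [map_smul, hAp, smul_comm]
    · simp [herm_smul_left, hpq]
  have h1' : herm q p = 1 := by rw [← star_herm, h1, star_one]
  have hαβ : α * star β = 1 := by
    have := herm_lin A p q
    rw [hAp, hAq, herm_smul_left, herm_smul_right, h1] at this
    linear_combination this
  have hα : α ≠ 0 := by rintro rfl; simp at hαβ
  set r : ℂ := (‖α‖ : ℂ) with hr
  have hr0 : r ≠ 0 := by simpa [hr] using hα
  have hrs : star r = r := by simp [hr]
  have hrr : r * r = α * star α := by
    rw [Complex.star_def, Complex.mul_conj', hr]; ring
  have hβ : β = α / r * r⁻¹ := by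
    have h2 : star α * β = 1 := by simpa using congrArg star hαβ
    have h3 : star α ≠ 0 := by simpa using hα
    field_simp
    rw [sq, hrr]
    linear_combination α * h2
  refine isReflectionTimes_of_family (p := ![p, q]) (G := !![0, 1; 1, 0])
    (a := ![!![0, r; r⁻¹, 0], !![0, 1; 1, 0], 1, 1])
    (v := ![1, -1]) (μ := α / r) ?_ ?_ ?_ ?_ ?_ ?_ ?_
  · intro i j; fin_cases i <;> fin_cases j <;> simp [hp, hq, h1, h1']
  · rw [Matrix.isUnit_iff_isUnit_det]; simp [Matrix.det_fin_two]
  · intro i; fin_cases i <;> simp [Matrix.one_fin_two, hr0]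
  · have hrs' : (starRingEnd ℂ) r = r := hrs
    intro i
    fin_cases i
    · ext i j
      fin_cases i <;> fin_cases j <;>
        simp [Matrix.mul_apply, Fin.sum_univ_two, hr0, hrs']
    · ext i j
      fin_cases i <;> fin_cases j <;> simp [Matrix.mul_apply, Fin.sum_univ_two]
    · simp
    · simp
  · simp [hr, hα]
  · intro j
    fin_cases j
    · simp [Fin.sum_univ_two, hAp, hr0]
    · simp [Fin.sum_univ_two, hAq, hβ]
  · simp [IsNeg, Fin.sum_univ_two, herm_add_left, herm_add_right, herm_neg_left, herm_neg_right,
      hp, hq, h1, h1']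

/-- Trace `0` and determinant `-1` give square `1` by Cayley–Hamilton. These are the involutions of
the hyperbolic plane out of which the unipotent block is built. -/
theorem trace_zero_involution {a b c : ℝ} (h : b * c = 1 + a ^ 2) :
    !![Complex.I * a, b; c, -(Complex.I * a)] * !![Complex.I * a, b; c, -(Complex.I * a)] = 1 ∧
    (!![Complex.I * a, b; c, -(Complex.I * a)])ᴴ * !![0, 1; 1, 0] *
      !![Complex.I * a, b; c, -(Complex.I * a)] = !![0, 1; 1, 0] := by
  have h' : (b : ℂ) * c = 1 + a ^ 2 := by exact_mod_cast h
  have hI := Complex.I_mul_I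
  constructor
  · ext i j
    fin_cases i <;> fin_cases j <;> simp
    · linear_combination h' + (a : ℂ) ^ 2 * hI
    · ring
    · ring
    · linear_combination h' + (a : ℂ) ^ 2 * hI
  · ext i j
    fin_cases i <;> fin_cases j <;> simp [Matrix.mul_apply, Fin.sum_univ_two]
    · ring
    · linear_combination h' + (a : ℂ) ^ 2 * hI
    · linear_combination h' + (a : ℂ) ^ 2 * hI
    · ring

theorem isReflectionTimes_of_jordan_two {A : U n} {x y : V n} {μ : ℂ} (hμ : ‖μ‖ = 1)
    (hx : lin A x = μ • (x + y)) (hy : lin A y = μ • y) (hyx : herm y x ≠ 0) :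
    IsReflectionTimes 1 4 (involutions (PU n)) (QuotientGroup.mk A) := by
  have hμs : star μ * μ = 1 := conj_mul_self_of_norm hμ
  set k := herm y x with hk
  have hxy : herm x y = star k := (star_herm _ _).symm
  have hyy : herm y y = 0 := by
    have := herm_lin A x y
    rw [hx, hy, herm_smul_left, herm_smul_right, herm_add_left] at this
    linear_combination this - (herm x y + herm y y) * hμs
  have hks : star k = -k := by
    have := herm_lin A x x
    rw [hx, herm_smul_left, herm_smul_right, herm_add_left, herm_add_right, herm_add_right, hyy,
      hxy, ← hk] at this
    linear_combination this - (herm x x + star k + k) * hμs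
  obtain ⟨t, ht⟩ : ∃ t : ℝ, k = Complex.I * t := by
    refine ⟨k.im, Complex.ext ?_ (by simp)⟩
    have := congrArg Complex.re hks
    simp at this ⊢
    linarith
  obtain ⟨g, hg⟩ : ∃ g : ℝ, herm x x = g := ⟨_, herm_self_eq x⟩
  -- `y` is null and `k` is purely imaginary. Rescaling `y` and correcting `x` gives a hyperbolic
  -- pair `e`, `f` in which `μ⁻¹ A` is `!![1, k; 0, 1]`.
  set e : V n := k⁻¹ • y with he
  have hye : y = k • e := by rw [he, smul_smul, mul_inv_cancel₀ hyx, one_smul]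
  have hee : herm e e = 0 := by rw [he, herm_smul_left, herm_smul_right, hyy]; simp
  have hex : herm e x = 1 := by rw [he, herm_smul_left, ← hk, inv_mul_cancel₀ hyx]
  have hxe : herm x e = 1 := by rw [← star_herm, hex, star_one]
  have hAe : lin A e = μ • e := by rw [he, map_smul, hy, smul_comm]
  set f : V n := x - (g / 2 : ℂ) • e with hf
  have hff : herm f f = 0 := by
    simp [hf, herm_sub_left, herm_sub_right, herm_smul_left, herm_smul_right, hg, hex, hxe, hee]
    ring
  have hef : herm e f = 1 := by
    simp [hf, herm_sub_right, herm_smul_right, hex, hee]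
  have hfe : herm f e = 1 := by rw [← star_herm, hef, star_one]
  have hAf : lin A f = μ • (f + k • e) := by
    rw [hf, map_sub, map_smul, hAe, hx, hye]
    module
  have h1 : (2 : ℝ) * (1 / 2) = 1 + 0 ^ 2 := by norm_num
  have h2 : (1 : ℝ) * 1 = 1 + 0 ^ 2 := by norm_num
  have h3 : (1 + t ^ 2 / 9) * 1 = 1 + (t / 3) ^ 2 := by ring
  have h4 : (2 + t ^ 2 / 18) * (1 / 2) = 1 + (t / 6) ^ 2 := by ring
  let M : ℝ → ℝ → ℝ → Matrix (Fin 2) (Fin 2) ℂ := fun a b c =>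
    !![Complex.I * a, b; c, -(Complex.I * a)]
  have hM : M 0 2 (1 / 2) * M 0 1 1 * M (t / 3) (1 + t ^ 2 / 9) 1 *
      M (t / 6) (2 + t ^ 2 / 18) (1 / 2) = !![1, k; 0, 1] := by
    -- The first two factors multiply to `diag(2, 1/2)`, the last two to `!![1/2, k/2; 0, 2]`: the
    -- unipotent matrix is a product of two hyperbolic ones, each of which is a product of two
    -- involutions.
    ext i j
    fin_cases i <;> fin_cases j <;> simp [M, ht] <;> ring_nf <;> simp
  refine isReflectionTimes_of_family (p := ![e, f]) (G := !![0, 1; 1, 0])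
    (a := ![M 0 2 (1 / 2), M 0 1 1, M (t / 3) (1 + t ^ 2 / 9) 1,
      M (t / 6) (2 + t ^ 2 / 18) (1 / 2)])
    (v := ![1, -1]) (μ := μ) ?_ ?_ ?_ ?_ hμ ?_ ?_
  · intro i j; fin_cases i <;> fin_cases j <;> simp [hee, hff, hef, hfe]
  · rw [Matrix.isUnit_iff_isUnit_det]; simp [Matrix.det_fin_two]
  · intro i
    fin_cases i
    · exact (trace_zero_involution h1).1
    · exact (trace_zero_involution h2).1
    · exact (trace_zero_involution h3).1
    · exact (trace_zero_involution h4).1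
  · intro i
    fin_cases i
    · exact (trace_zero_involution h1).2
    · exact (trace_zero_involution h2).2
    · exact (trace_zero_involution h3).2
    · exact (trace_zero_involution h4).2
  · intro j
    fin_cases j
    · simp [-one_div, Fin.sum_univ_two, hAe, hM]
    · simp [-one_div, Fin.sum_univ_two, hAf, hM]
      module
  · simp [IsNeg, Fin.sum_univ_two, herm_add_left, herm_add_right, herm_neg_left, herm_neg_right,
      hee, hff, hef, hfe]

theorem isReflectionTimes_of_jordan_three {A : U n} {x y z : V n} {μ : ℂ} (hμ : ‖μ‖ = 1)
    (hx : lin A x = μ • (x + y)) (hy : lin A y = μ • (y + z)) (hz : lin A z = μ • z)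
    (hzx : herm z x ≠ 0) :
    IsReflectionTimes 2 4 (involutions (PU n)) (QuotientGroup.mk A) := by
  have hμs : star μ * μ = 1 := conj_mul_self_of_norm hμ
  have hA : ∀ a b a' b', lin A a = μ • a' → lin A b = μ • b' → herm a' b' = herm a b := by
    intro a b a' b' h1 h2
    rw [← herm_lin A a b, h1, h2, herm_smul_left, herm_smul_right]
    linear_combination -herm a' b' * hμs
  have hzz : herm z z = 0 := by
    have := hA y z _ _ hy hz
    rw [herm_add_left] at this
    linear_combination this
  have hyz : herm y z = 0 := by
    have := hA x z _ _ hx hz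
    rw [herm_add_left] at this
    linear_combination this
  have hzy : herm z y = 0 := by rw [← star_herm, hyz, star_zero]
  obtain ⟨q, hq⟩ : ∃ q : ℝ, herm y y = q := ⟨_, herm_self_eq y⟩
  have hxz : herm x z = -q := by
    have := hA x y _ _ hx hy
    rw [herm_add_left, herm_add_right, herm_add_right, hq, hyz] at this
    linear_combination this
  have hzx' : herm z x = -q := by rw [← star_herm, hxz]; simp
  have hq0 : (q : ℂ) ≠ 0 := by rintro h; rw [hzx', h, neg_zero] at hzx; exact hzx rfl
  have hxy : herm x y = -herm y x - q := by
    have := hA x x _ _ hx hx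
    rw [herm_add_left, herm_add_right, herm_add_right, hq] at this
    linear_combination this
  obtain ⟨κ, hκ⟩ : ∃ κ : ℝ, herm y x = Complex.I * κ - q / 2 := by
    refine ⟨(herm y x).im, Complex.ext ?_ (by simp)⟩
    have := congrArg Complex.re hxy
    rw [← star_herm] at this
    simp at this ⊢
    linarith
  rw [hκ] at hxy
  -- This `s` makes `e₂` orthogonal to `e₃`. The multiples of `z` in `e₂` and `e₃` are chosen so
  -- that `μ⁻¹ A` becomes `exp L`, with `L` the nilpotent Jordan block in the basis `z, e₂, e₃`.
  set s : ℂ := Complex.I * κ / (2 * q) with hs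
  set e₂ : V n := y + (s - 1 / 2) • z with he₂
  set e₃ : V n := x + s • y - (s / 2) • z with he₃
  have hss : (starRingEnd ℂ) s = -s := by simp [hs, neg_div, map_ofNat]
  have hsq : s * q = Complex.I * κ / 2 := by rw [hs]; field_simp
  obtain ⟨g, hg⟩ : ∃ g : ℝ, herm e₃ e₃ = g := ⟨_, herm_self_eq e₃⟩
  have h12 : herm z e₂ = 0 := by simp [he₂, herm_add_right, herm_smul_right, hzy, hzz]
  have h13 : herm z e₃ = -q := by
    simp [he₃, herm_add_right, herm_sub_right, herm_smul_right, hzy, hzz, hzx']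
  have h22 : herm e₂ e₂ = q := by
    simp [he₂, herm_add_right, herm_add_left, herm_smul_right, herm_smul_left, hzy, hyz, hzz, hq]
  have h23 : herm e₂ e₃ = 0 := by
    simp [he₂, he₃, herm_add_right, herm_add_left, herm_sub_right, herm_smul_right,
      herm_smul_left, hzy, hyz, hzz, hq, hzx', hκ, hss]
    linear_combination -2 * hsq
  have h21 : herm e₂ z = 0 := by rw [← star_herm, h12, star_zero]
  have h31 : herm e₃ z = -q := by rw [← star_herm, h13]; simp
  have h32 : herm e₃ e₂ = 0 := by rw [← star_herm, h23, star_zero]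
  have hA2 : lin A e₂ = μ • (e₂ + z) := by
    rw [he₂, map_add, map_smul, hy, hz]; module
  have hA3 : lin A e₃ = μ • (e₃ + e₂ + (1 / 2 : ℂ) • z) := by
    rw [he₃, he₂, map_sub, map_add, map_smul, map_smul, hx, hy, hz]; module
  -- `diag(1, -1, 1)` conjugates `L` to `-L`, so it inverts `exp L`, and its product with `exp L` is
  -- the second involution. The coefficient of `z` in `v` is solved from `⟨v, v⟩ = -1`.
  refine isReflectionTimes_of_family (p := ![z, e₂, e₃])
    (G := !![0, 0, -(q : ℂ); 0, q, 0; -q, 0, g])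
    (a := ![!![1, 0, 0; 0, -1, 0; 0, 0, 1], !![1, 1, 1 / 2; 0, -1, -1; 0, 0, 1], 1, 1])
    (v := ![(g + 1) / (2 * q), 0, 1]) (μ := μ) ?_ ?_ ?_ ?_ hμ ?_ ?_
  · intro i j
    fin_cases i <;> fin_cases j <;> simp [hzz, h12, h13, h22, h23, h21, h31, h32, hg]
  · rw [Matrix.isUnit_iff_isUnit_det]; simpa [Matrix.det_fin_three] using hq0
  · intro i
    fin_cases i <;> simp [Matrix.one_fin_three]
    norm_num
  · intro i
    fin_cases i
    · ext i j
      fin_cases i <;> fin_cases j <;> simp [Matrix.mul_apply, Fin.sum_univ_three]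
    · ext i j
      fin_cases i <;> fin_cases j <;> simp [Matrix.mul_apply, Fin.sum_univ_three, map_ofNat]
      ring
    · simp
    · simp
  · intro j
    fin_cases j
    · simp [Fin.sum_univ_three, hz]
    · simp [Fin.sum_univ_three, hA2]
      module
    · simp [Fin.sum_univ_three, hA3]
      module
  · have : herm (∑ i, ![((g : ℂ) + 1) / (2 * q), 0, 1] i • ![z, e₂, e₃] i)
        (∑ i, ![((g : ℂ) + 1) / (2 * q), 0, 1] i • ![z, e₂, e₃] i) = -1 := by
      simp [Fin.sum_univ_three, herm_add_left, herm_add_right, herm_smul_left, herm_smul_right,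
        hzz, h13, h31, hg, Complex.conj_ofReal]
      field_simp
      ring
    rw [IsNeg, this]
    simp

end NormalForms

/-! ### The nilpotent part `N` of `A = μ (1 + N)`. -/

section Nilpotent

variable {n : ℕ}

/-- The image of `N ^ j` is orthogonal to the kernel of `N ^ j` when `1 + N` is an isometry. -/
theorem herm_pow_apply_eq_zero {N : Module.End ℂ (V n)}
    (hN : ∀ x y, herm (x + N x) (y + N y) = herm x y) :
    ∀ (j : ℕ) (a b : V n), (N ^ j) b = 0 → herm ((N ^ j) a) b = 0 := by
  intro j
  induction j with
  | zero => intro a b hb; simp only [pow_zero, Module.End.one_apply] at hb ⊢; simp [hb]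
  | succ j ih =>
    intro a b hb
    have hb' : (N ^ j) (N b) = 0 := by rw [← hb, pow_succ, Module.End.mul_apply]
    -- Expanding the isometry relation writes the new pairing as minus two pairings with `N b`,
    -- which `N ^ j` kills.
    have h1 := hN ((N ^ j) a) b
    have h2 := ih a _ hb'
    have h3 := ih (N a) _ hb'
    rw [← Module.End.mul_apply, ← pow_succ, pow_succ', Module.End.mul_apply] at h3
    rw [pow_succ', Module.End.mul_apply]
    rw [herm_add_left, herm_add_right, herm_add_right] at h1
    linear_combination h1 - h2 - h3

/-- For `d ≥ 3` both `N ^ (d - 1) x` and `N ^ d x` lie in the image and in the kernel of `N ^ 2`,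
hence span an isotropic space. In signature `(n,1)` they must be proportional; applying `N` to the
proportionality kills `N ^ d x`. -/
theorem pow_three_eq_zero_of_isometry {N : Module.End ℂ (V n)}
    (hN : ∀ x y, herm (x + N x) (y + N y) = herm x y) {d : ℕ} (hd : 3 ≤ d) {x : V n}
    (hx : (N ^ (d + 1)) x = 0) : (N ^ d) x = 0 := by
  obtain ⟨k, rfl⟩ := Nat.exists_eq_add_of_le hd
  set a := (N ^ (k + 2)) x with ha
  have hNa : N a = (N ^ (3 + k)) x := by
    rw [ha, ← Module.End.mul_apply, ← pow_succ']; congr 2; omega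
  have hNNa : N (N a) = 0 := by
    rw [hNa, ← Module.End.mul_apply, ← pow_succ', hx]
  have hker : (N ^ 2) a = 0 := by rw [sq, Module.End.mul_apply, hNNa]
  have hker' : (N ^ 2) (N a) = 0 := by rw [sq, Module.End.mul_apply, hNNa, map_zero]
  have hra : a = (N ^ 2) ((N ^ k) x) := by
    rw [ha, ← Module.End.mul_apply, ← pow_add, add_comm 2 k]
  have hrb : N a = (N ^ 2) ((N ^ (k + 1)) x) := by
    rw [hNa, ← Module.End.mul_apply, ← pow_add]; congr 2; omega
  have haa : herm a a = 0 := by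
    conv_lhs => arg 1; rw [hra]
    exact herm_pow_apply_eq_zero hN 2 _ _ hker
  have hab : herm a (N a) = 0 := by
    conv_lhs => arg 1; rw [hra]
    exact herm_pow_apply_eq_zero hN 2 _ _ hker'
  have hbb : herm (N a) (N a) = 0 := by
    conv_lhs => arg 1; rw [hrb]
    exact herm_pow_apply_eq_zero hN 2 _ _ hker'
  rw [← hNa]
  by_contra hne
  have h0 := apply_zero_ne_zero_of_isNull hbb hne
  have h1 := congrArg N (smul_eq_smul_of_isNull haa hbb hab)
  rw [map_smul, map_smul, hNNa, smul_zero] at h1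
  exact (smul_ne_zero h0 hne) h1

/-- Complex polarization: if `⟨M x, x⟩` vanished on all of `P`, so would `⟨M x, y⟩`, against
non-degeneracy. Applied to the top power of `N`, it supplies the head of a Jordan chain with
non-degenerate span. -/
theorem exists_herm_apply_self_ne_zero {P : Submodule ℂ (V n)} {M : Module.End ℂ (V n)}
    (hMP : ∀ x ∈ P, M x ∈ P) (hP : ∀ x ∈ P, (∀ y ∈ P, herm x y = 0) → x = 0)
    (hM : ∃ x ∈ P, M x ≠ 0) : ∃ x ∈ P, herm (M x) x ≠ 0 := by
  by_contra! hcon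
  obtain ⟨x, hx, hMx⟩ := hM
  refine hMx (hP _ (hMP x hx) fun y hy => ?_)
  have hxx := hcon x hx
  have hyy := hcon y hy
  have h1 := hcon (x + y) (P.add_mem hx hy)
  have h2 := hcon (x + Complex.I • y) (P.add_mem hx (P.smul_mem _ hy))
  simp only [map_add, map_smul, herm_add_left, herm_add_right, herm_smul_left, herm_smul_right,
    hxx, hyy, Complex.star_def, Complex.conj_I] at h1 h2
  linear_combination (1 / 2 : ℂ) * h1 + (Complex.I / 2) * h2 -
    (1 / 2 : ℂ) * (herm (M y) x - herm (M x) y) * Complex.I_mul_I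

variable {A : U n} {μ : ℂ}

/-- The operator `N` with `A = μ (1 + N)`. -/
def shift (A : U n) (μ : ℂ) : Module.End ℂ (V n) := μ⁻¹ • lin A - 1

theorem lin_eq_shift (hμ : ‖μ‖ = 1) (x : V n) : lin A x = μ • (x + shift A μ x) := by
  have h0 : μ ≠ 0 := by rintro rfl; simp at hμ
  simp [shift, smul_smul, h0]

theorem shift_isometry (hμ : ‖μ‖ = 1) (x y : V n) :
    herm (x + shift A μ x) (y + shift A μ y) = herm x y := by
  have hμs : star μ * μ = 1 := conj_mul_self_of_norm hμ
  rw [← herm_lin A x y, lin_eq_shift hμ, lin_eq_shift hμ, herm_smul_left, herm_smul_right]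
  linear_combination -herm (x + shift A μ x) (y + shift A μ y) * hμs

theorem pow_apply_mem {P : Submodule ℂ (V n)} {N : Module.End ℂ (V n)}
    (hNP : ∀ x ∈ P, N x ∈ P) (j : ℕ) : ∀ x ∈ P, (N ^ j) x ∈ P := by
  induction j with
  | zero => intro x hx; simpa using hx
  | succ j ih =>
    intro x hx
    rw [pow_succ', Module.End.mul_apply]
    exact hNP _ (ih x hx)

theorem isReflectionTimes_of_shift (hμ : ‖μ‖ = 1) {P : Submodule ℂ (V n)}
    (hNP : ∀ x ∈ P, shift A μ x ∈ P) (hP : ∀ x ∈ P, (∀ y ∈ P, herm x y = 0) → x = 0)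
    {d : ℕ} (hd0 : d ≠ 0) (hz : ∀ x ∈ P, (shift A μ ^ (d + 1)) x = 0)
    (hnz : ∃ x ∈ P, (shift A μ ^ d) x ≠ 0) :
    d ≤ 2 ∧ IsReflectionTimes d 4 (involutions (PU n)) (QuotientGroup.mk A) := by
  have hd : d ≤ 2 := by
    by_contra! h
    obtain ⟨x, hx, hne⟩ := hnz
    exact hne (pow_three_eq_zero_of_isometry (shift_isometry hμ) h (hz x hx))
  refine ⟨hd, ?_⟩
  obtain ⟨x, hx, hxx⟩ := exists_herm_apply_self_ne_zero (pow_apply_mem hNP d) hP hnz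
  have hz' := hz x hx
  have key := fun y : V n => lin_eq_shift (A := A) hμ y
  obtain rfl | rfl : d = 1 ∨ d = 2 := by omega
  · rw [pow_one] at hxx
    refine isReflectionTimes_of_jordan_two hμ (key x) ?_ hxx
    rw [key]
    rw [pow_succ, pow_one, Module.End.mul_apply] at hz'
    rw [hz', add_zero]
  · rw [pow_succ, pow_one, Module.End.mul_apply] at hxx
    refine isReflectionTimes_of_jordan_three hμ (key x) (key _) ?_ hxx
    rw [key]
    rw [pow_succ, pow_succ, pow_one, Module.End.mul_apply, Module.End.mul_apply] at hz'
    rw [hz', add_zero]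

end Nilpotent

/-! ### Every isometry contains one of the model blocks. -/

section Classification

variable {n : ℕ}

theorem isNull_of_norm_ne_one {A : U n} {v : V n} {μ : ℂ} (hA : lin A v = μ • v)
    (hμ : ‖μ‖ ≠ 1) : IsNull v := by
  have h1 := herm_lin A v v
  rw [hA, herm_smul_left, herm_smul_right, ← mul_assoc, Complex.star_def,
    Complex.mul_conj'] at h1
  by_contra h0
  have h2 : ((‖μ‖ : ℂ)) ^ 2 = 1 := mul_right_cancel₀ h0 (by rw [h1, one_mul])
  have h3 : ‖μ‖ ^ 2 = 1 := by exact_mod_cast h2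
  exact hμ ((pow_eq_one_iff_of_nonneg (norm_nonneg _) two_ne_zero).1 h3)

theorem herm_ne_zero_of_isNull {p q : V n} (hp : IsNull p) (hq : IsNull q) (hp0 : p ≠ 0)
    (h : ∀ c : ℂ, q ≠ c • p) : herm p q ≠ 0 := by
  intro hpq
  have h1 := smul_eq_smul_of_isNull hp hq hpq
  have hp' := apply_zero_ne_zero_of_isNull hp hp0
  refine h ((p 0)⁻¹ * q 0) ?_
  rw [mul_smul, h1, smul_smul, inv_mul_cancel₀ hp', one_smul]

theorem isReflectionTimes_of_norm_ne_one {A : U n} {v : V n} {μ : ℂ} (hv : v ≠ 0)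
    (hA : lin A v = μ • v) (hμ : ‖μ‖ ≠ 1) :
    IsReflectionTimes 1 4 (involutions (PU n)) (QuotientGroup.mk A) := by
  have hμ0 : μ ≠ 0 := by
    rintro rfl
    rw [zero_smul] at hA
    exact hv (lin_injective A (by rw [hA, map_zero]))
  have hvn := isNull_of_norm_ne_one hA hμ
  set ν : ℂ := (star μ)⁻¹ with hν
  have hνμ : μ * star ν = 1 := by simp [hν, hμ0]
  have hν1 : ‖ν‖ ≠ 1 := by
    rw [hν, norm_inv, norm_star]
    intro h
    exact hμ (inv_eq_one.1 h)
  -- The image of `A - ν` is orthogonal to `v`, because `μ * star ν = 1`. So `A - ν` is not onto,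
  -- and `ν` is a second eigenvalue.
  have hni : ¬ Function.Injective (lin A - ν • (1 : Module.End ℂ (V n))) := by
    intro hinj
    have hsurj := LinearMap.injective_iff_surjective.1 hinj
    refine hv (herm_nondegenerate fun y => ?_)
    obtain ⟨z, rfl⟩ := hsurj y
    have h1 := herm_lin A v z
    rw [hA, herm_smul_left] at h1
    simp only [LinearMap.sub_apply, LinearMap.smul_apply, Module.End.one_apply, herm_sub_right,
      herm_smul_right]
    apply mul_left_cancel₀ hμ0
    linear_combination h1 - herm v z * hνμ
  obtain ⟨w, hw, hw0⟩ : ∃ w, lin A w = ν • w ∧ w ≠ 0 := by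
    by_contra! hcon
    refine hni ((injective_iff_map_eq_zero _).2 fun w hw => hcon w ?_)
    simpa [sub_eq_zero] using hw
  refine isReflectionTimes_of_null_eigenvectors hvn (isNull_of_norm_ne_one hw hν1) ?_ hA hw
  refine herm_ne_zero_of_isNull hvn (isNull_of_norm_ne_one hw hν1) hv fun c hc => ?_
  have h2 : (ν - μ) • w = 0 := by
    rw [sub_smul, ← hw]
    conv_lhs => arg 1; rw [hc, map_smul, hA]
    rw [hc, smul_comm, sub_self]
  have h3 : ν = μ := sub_eq_zero.1 ((smul_eq_zero.1 h2).resolve_right hw0)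
  rw [h3, Complex.star_def, Complex.mul_conj'] at hνμ
  have h4 : ‖μ‖ ^ 2 = 1 := by exact_mod_cast hνμ
  exact hμ ((pow_eq_one_iff_of_nonneg (norm_nonneg _) two_ne_zero).1 h4)

/-- Double induction on the nilpotency exponents: in `⟨A x, A y⟩ = ⟨x, y⟩` every term except `μ *
star ν * ⟨x, y⟩` involves a shorter chain. -/
theorem herm_eq_zero_of_genEigenspace {A : U n} {μ ν : ℂ} (hμν : μ * star ν ≠ 1) :
    ∀ (k l : ℕ) (x y : V n), ((lin A - μ • (1 : Module.End ℂ (V n))) ^ k) x = 0 →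
      ((lin A - ν • (1 : Module.End ℂ (V n))) ^ l) y = 0 → herm x y = 0 := by
  intro k
  induction k with
  | zero => intro l x y hx _; simp at hx; simp [hx]
  | succ k ihk =>
    intro l
    induction l with
    | zero => intro x y _ hy; simp at hy; simp [hy]
    | succ l ihl =>
      intro x y hx hy
      set x' := (lin A - μ • (1 : Module.End ℂ (V n))) x with hx'
      set y' := (lin A - ν • (1 : Module.End ℂ (V n))) y with hy'
      have e1 : lin A x = x' + μ • x := by simp [hx']
      have e2 : lin A y = y' + ν • y := by simp [hy']
      have hx1 : ((lin A - μ • (1 : Module.End ℂ (V n))) ^ k) x' = 0 := by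
        rw [hx', ← Module.End.mul_apply, ← pow_succ, hx]
      have hy1 : ((lin A - ν • (1 : Module.End ℂ (V n))) ^ l) y' = 0 := by
        rw [hy', ← Module.End.mul_apply, ← pow_succ, hy]
      have hy2 : ((lin A - ν • (1 : Module.End ℂ (V n))) ^ (l + 1)) y' = 0 := by
        rw [pow_succ', Module.End.mul_apply, hy1, map_zero]
      have h1 := herm_lin A x y
      rw [e1, e2, herm_add_left, herm_add_right, herm_add_right, herm_smul_left, herm_smul_right,
        herm_smul_right, herm_smul_left, ihk _ _ _ hx1 hy2, ihk _ _ _ hx1 hy,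
        ihl _ _ hx hy1] at h1
      have h2 : (μ * star ν - 1) * herm x y = 0 := by linear_combination h1
      exact (mul_eq_zero.1 h2).resolve_left (sub_ne_zero.2 hμν)

theorem exists_isReflectionTimes (A : U n) :
    ∃ k ≤ 2, IsReflectionTimes k 4 (involutions (PU n)) (QuotientGroup.mk A) := by
  by_cases hneg : ∃ v : V n, IsNeg v ∧ ∃ μ : ℂ, lin A v = μ • v
  · obtain ⟨v, hv, μ, h⟩ := hneg
    exact ⟨0, by norm_num, isReflectionTimes_of_negative_eigenvector hv h⟩
  by_cases hnorm : ∃ (v : V n) (μ : ℂ), v ≠ 0 ∧ lin A v = μ • v ∧ ‖μ‖ ≠ 1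
  · obtain ⟨v, μ, hv, h, hμ⟩ := hnorm
    exact ⟨1, by norm_num, isReflectionTimes_of_norm_ne_one hv h hμ⟩
  push Not at hneg hnorm
  let E : ℂ → Submodule ℂ (V n) := Module.End.maxGenEigenspace (lin A)
  have hE : ∀ μ x, x ∈ E μ ↔ ∃ k : ℕ, ((lin A - μ • (1 : Module.End ℂ (V n))) ^ k) x = 0 :=
    fun μ x => Module.End.mem_maxGenEigenspace _ _ _
  have htop : ⨆ μ, E μ = ⊤ := Module.End.iSup_maxGenEigenspace_eq_top _
  have hEnorm : ∀ μ, E μ ≠ ⊥ → ‖μ‖ = 1 := by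
    intro μ hμ
    have hev : Module.End.HasEigenvalue (lin A) μ :=
      Module.End.HasUnifEigenvalue.lt (k := ⊤) zero_lt_one hμ
    obtain ⟨v, hv⟩ := hev.exists_hasEigenvector
    exact hnorm v μ hv.2 hv.apply_eq_smul
  have horth : ∀ μ ν, μ ≠ ν → ∀ x ∈ E μ, ∀ y ∈ E ν, herm x y = 0 := by
    intro μ ν hne x hx y hy
    by_cases hx0 : x = 0
    · simp [hx0]
    by_cases hy0 : y = 0
    · simp [hy0]
    have hν := conj_mul_self_of_norm (hEnorm ν fun h => hy0 (by simpa [h] using hy))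
    obtain ⟨k, hk⟩ := (hE μ x).1 hx
    obtain ⟨l, hl⟩ := (hE ν y).1 hy
    refine herm_eq_zero_of_genEigenspace (fun h => hne ?_) k l x y hk hl
    calc μ = (μ * star ν) * ν := by rw [mul_assoc, hν, mul_one]
      _ = ν := by rw [h, one_mul]
  have hnondeg : ∀ μ, ∀ x ∈ E μ, (∀ y ∈ E μ, herm x y = 0) → x = 0 := by
    intro μ x hx h
    refine herm_nondegenerate fun y => ?_
    have hy : y ∈ ⨆ ν, E ν := htop ▸ Submodule.mem_top
    induction hy using Submodule.iSup_induction' with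
    | mem ν y hy =>
      by_cases hμν : μ = ν
      · subst hμν; exact h y hy
      · exact horth μ ν hμν x hx y hy
    | zero => simp
    | add y z _ _ hy hz => rw [herm_add_right, hy, hz, add_zero]
  -- If `A` were a scalar on each `E μ`, a negative vector would be a sum of mutually orthogonal
  -- eigenvectors, and one of these would have to be negative.
  by_cases hss : ∀ μ, ∀ x ∈ E μ, lin A x = μ • x
  · exfalso
    obtain ⟨v, hv⟩ := exists_isNeg n
    have hv' : v ∈ ⨆ ν, E ν := htop ▸ Submodule.mem_top
    obtain ⟨f, hf, rfl⟩ := (Submodule.mem_iSup_iff_exists_finsupp _ _).1 hv'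
    have hsum : herm (f.sum fun _ x => x) (f.sum fun _ x => x) =
        ∑ μ ∈ f.support, herm (f μ) (f μ) := by
      rw [Finsupp.sum, herm_sum_left]
      refine Finset.sum_congr rfl fun μ hμ => ?_
      rw [herm_sum_right, Finset.sum_eq_single μ]
      · intro ν _ hne
        exact horth μ ν hne.symm _ (hf μ) _ (hf ν)
      · exact fun h => absurd hμ h
    rw [IsNeg, hsum, Complex.re_sum] at hv
    obtain ⟨μ, -, hμ⟩ := Finset.exists_lt_of_sum_lt
      (lt_of_lt_of_eq hv (Finset.sum_const_zero (s := f.support)).symm)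
    exact hneg _ hμ μ (hss μ _ (hf μ))
  · push Not at hss
    obtain ⟨μ, x, hx, hne⟩ := hss
    have hμ : ‖μ‖ = 1 := hEnorm μ fun h => hne (by
      have : x = 0 := by simpa [h] using hx
      simp [this])
    have hμ0 : μ ≠ 0 := by rintro rfl; simp at hμ
    have hshift : shift A μ = μ⁻¹ • (lin A - μ • (1 : Module.End ℂ (V n))) := by
      rw [shift, smul_sub, smul_smul, inv_mul_cancel₀ hμ0, one_smul]
    have hnil : ∃ K, ∀ x ∈ E μ, (shift A μ ^ K) x = 0 := by
      refine ⟨Module.finrank ℂ (V n), fun x hx => ?_⟩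
      have hx' : x ∈ Module.End.maxGenEigenspace (lin A) μ := hx
      rw [Module.End.maxGenEigenspace_eq_genEigenspace_finrank, Module.End.mem_genEigenspace_nat,
        LinearMap.mem_ker] at hx'
      rw [hshift, smul_pow, LinearMap.smul_apply, hx', smul_zero]
    have hstab : ∀ x ∈ E μ, shift A μ x ∈ E μ := by
      intro x hx
      rw [shift]
      exact (E μ).sub_mem ((E μ).smul_mem _
        (Module.End.mapsTo_maxGenEigenspace_of_comm (Commute.refl (lin A)) μ hx)) hx
    classical
    -- The nilpotency index of `N` on `E μ`. It is at least `2` since `N x ≠ 0`, so its top non-zero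
    -- power `e + 1` is positive.
    set d := Nat.find hnil with hd
    have hdz : ∀ x ∈ E μ, (shift A μ ^ d) x = 0 := Nat.find_spec hnil
    have hNx : shift A μ x ≠ 0 := by
      intro h
      apply hne
      rw [lin_eq_shift hμ, h, add_zero]
    obtain ⟨e, he⟩ : ∃ e, d = e + 2 := by
      refine ⟨d - 2, ?_⟩
      have h0 : d ≠ 0 := by
        intro h
        have := hdz x hx
        rw [h] at this
        simp only [pow_zero, Module.End.one_apply] at this
        exact hNx (by rw [this, map_zero])
      have h1 : d ≠ 1 := by
        intro h
        have := hdz x hx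
        rw [h, pow_one] at this
        exact hNx this
      omega
    have hnz : ∃ x ∈ E μ, (shift A μ ^ (e + 1)) x ≠ 0 := by
      have := Nat.find_min hnil (m := e + 1) (by omega)
      push Not at this
      exact this
    rw [he] at hdz
    exact ⟨e + 1, isReflectionTimes_of_shift hμ hstab (hnondeg μ) (by omega) hdz hnz⟩

theorem exists_eigenvector_of_act_eq {A : U n} {v : V n} (hv : v ≠ 0)
    (h : act A (Projectivization.mk ℂ v hv) = Projectivization.mk ℂ v hv) :
    ∃ μ : ℂ, lin A v = μ • v := by
  rw [act, Projectivization.map_mk, Projectivization.mk_eq_mk_iff'] at h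
  obtain ⟨a, ha⟩ := h
  exact ⟨a, ha.symm⟩

theorem IsElliptic.isReflectionTimes {A : U n} (h : IsElliptic A) :
    IsReflectionTimes 0 4 (involutions (PU n)) (QuotientGroup.mk A) := by
  obtain ⟨_, ⟨v, hv0, hv, rfl⟩, hfix⟩ := h
  obtain ⟨μ, hμ⟩ := exists_eigenvector_of_act_eq hv0 hfix
  exact isReflectionTimes_of_negative_eigenvector hv hμ

theorem IsHyperbolic.isReflectionTimes {A : U n} (h : IsHyperbolic A) :
    IsReflectionTimes 1 4 (involutions (PU n)) (QuotientGroup.mk A) := by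
  obtain ⟨_, ⟨p, hp0, hp, rfl⟩, _, ⟨q, hq0, hq, rfl⟩, hne, hfix⟩ := h
  have h1 : Projectivization.mk ℂ p hp0 ∈ fixedPts A := by rw [hfix]; simp
  have h2 : Projectivization.mk ℂ q hq0 ∈ fixedPts A := by rw [hfix]; simp
  obtain ⟨α, hα⟩ := exists_eigenvector_of_act_eq hp0 h1.2
  obtain ⟨β, hβ⟩ := exists_eigenvector_of_act_eq hq0 h2.2
  refine isReflectionTimes_of_null_eigenvectors hp hq ?_ hα hβ
  refine herm_ne_zero_of_isNull hp hq hp0 fun c hc => hne ?_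
  exact ((Projectivization.mk_eq_mk_iff' ℂ q p hq0 hp0).2 ⟨c, hc.symm⟩).symm

/-- The minimal polynomial `(X - μ) ^ (d + 1)` on `P` says exactly that `N ^ (d + 1)` vanishes on
`P` and `N ^ d` does not, which is what `isReflectionTimes_of_shift` needs. -/
theorem HasBlock.isReflectionTimes {A : U n} {d : ℕ} (hd : d ≠ 0) (h : HasBlock (d + 1) A) :
    IsReflectionTimes d 4 (involutions (PU n)) (QuotientGroup.mk A) := by
  obtain ⟨P, W, hP, -, μ, -, -, hind, -, hμ, -, hmin, -⟩ := h
  have hμ0 : μ ≠ 0 := by rintro rfl; simp at hμ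
  have hshift : shift A μ = μ⁻¹ • (lin A - μ • (1 : Module.End ℂ (V n))) := by
    rw [shift, smul_sub, smul_smul, inv_mul_cancel₀ hμ0, one_smul]
  have hstab : ∀ x ∈ P, shift A μ x ∈ P := fun x hx => by
    rw [shift]
    exact P.sub_mem (P.smul_mem _ (hP x hx)) hx
  have hpow : ∀ (j : ℕ) (x : P), (Polynomial.aeval ((lin A).restrict hP)
      ((Polynomial.X - Polynomial.C μ) ^ j) x : V n) = μ ^ j • (shift A μ ^ j) x := by
    intro j
    induction j with
    | zero => intro x; simp
    | succ j ih =>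
      intro x
      rw [pow_succ, map_mul, Module.End.mul_apply, ih, pow_succ (shift A μ), Module.End.mul_apply,
        pow_succ μ, mul_smul, ← map_smul]
      simp [hshift, smul_smul, hμ0, Module.algebraMap_end_apply]
  refine (isReflectionTimes_of_shift hμ hstab hind.1 hd ?_ ?_).2
  · intro x hx
    have h1 := hpow (d + 1) ⟨x, hx⟩
    have h0 : Polynomial.aeval ((lin A).restrict hP)
        ((Polynomial.X - Polynomial.C μ) ^ (d + 1)) = 0 := by
      rw [← hmin]
      exact minpoly.aeval ℂ (B := Module.End ℂ P) ((lin A).restrict hP)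
    rw [h0] at h1
    exact (smul_eq_zero.1 h1.symm).resolve_left (pow_ne_zero _ hμ0)
  · by_contra! hcon
    have h1 : Polynomial.aeval ((lin A).restrict hP) ((Polynomial.X - Polynomial.C μ) ^ d) = 0 := by
      ext1 x
      apply Subtype.ext
      rw [hpow, hcon x x.2]
      simp
    have h2 := minpoly.min ℂ ((lin A).restrict hP) ((Polynomial.monic_X_sub_C μ).pow d) h1
    rw [hmin, Polynomial.degree_pow, Polynomial.degree_pow, Polynomial.degree_X_sub_C] at h2
    simp only [nsmul_eq_mul, mul_one] at h2
    have h3 : d + 1 ≤ d := by exact_mod_cast h2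
    omega

end Classification

end CHyp

end

theorem theorem4p1 (n : ℕ) (T : CHyp.PU n) :
    ((∃ k ≤ 2, CHyp.IsReflectionTimes k 4 (CHyp.involutions (CHyp.PU n)) T) ∧
      (CHyp.Lifts CHyp.IsElliptic T →
        CHyp.IsReflectionTimes 0 4 (CHyp.involutions (CHyp.PU n)) T) ∧
      (CHyp.Lifts CHyp.IsHyperbolic T →
        CHyp.IsReflectionTimes 1 4 (CHyp.involutions (CHyp.PU n)) T) ∧
      (CHyp.Lifts CHyp.IsElliptoTranslation T →
        CHyp.IsReflectionTimes 1 4 (CHyp.involutions (CHyp.PU n)) T) ∧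
      (2 < n → CHyp.Lifts CHyp.IsElliptoParabolic T →
        CHyp.IsReflectionTimes 2 4 (CHyp.involutions (CHyp.PU n)) T)) ∧
    ((∃ k ≤ 2, CHyp.IsReflectionTimes k 2 (CHyp.reversibles (CHyp.PU n)) T) ∧
      (CHyp.Lifts CHyp.IsElliptic T →
        CHyp.IsReflectionTimes 0 2 (CHyp.reversibles (CHyp.PU n)) T) ∧
      (CHyp.Lifts CHyp.IsHyperbolic T →
        CHyp.IsReflectionTimes 1 2 (CHyp.reversibles (CHyp.PU n)) T) ∧
      (CHyp.Lifts CHyp.IsElliptoTranslation T →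
        CHyp.IsReflectionTimes 1 2 (CHyp.reversibles (CHyp.PU n)) T) ∧
      (2 < n → CHyp.Lifts CHyp.IsElliptoParabolic T →
        CHyp.IsReflectionTimes 2 2 (CHyp.reversibles (CHyp.PU n)) T)) := by
  have h0 : ∃ k ≤ 2, CHyp.IsReflectionTimes k 4 (CHyp.involutions (CHyp.PU n)) T := by
    obtain ⟨A, rfl⟩ := QuotientGroup.mk_surjective T
    exact CHyp.exists_isReflectionTimes A
  have h1 : CHyp.Lifts CHyp.IsElliptic T →
      CHyp.IsReflectionTimes 0 4 (CHyp.involutions (CHyp.PU n)) T := by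
    rintro ⟨A, rfl, hA⟩
    exact hA.isReflectionTimes
  have h2 : CHyp.Lifts CHyp.IsHyperbolic T →
      CHyp.IsReflectionTimes 1 4 (CHyp.involutions (CHyp.PU n)) T := by
    rintro ⟨A, rfl, hA⟩
    exact hA.isReflectionTimes
  have h3 : CHyp.Lifts CHyp.IsElliptoTranslation T →
      CHyp.IsReflectionTimes 1 4 (CHyp.involutions (CHyp.PU n)) T := by
    rintro ⟨A, rfl, -, -, hA⟩
    exact CHyp.HasBlock.isReflectionTimes one_ne_zero hA
  have h4 : CHyp.Lifts CHyp.IsElliptoParabolic T →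
      CHyp.IsReflectionTimes 2 4 (CHyp.involutions (CHyp.PU n)) T := by
    rintro ⟨A, rfl, -, -, hA⟩
    exact CHyp.HasBlock.isReflectionTimes two_ne_zero hA
  refine ⟨⟨h0, h1, h2, h3, fun _ => h4⟩, ?_, fun h => (h1 h).reversibles,
    fun h => (h2 h).reversibles, fun h => (h3 h).reversibles, fun _ h => (h4 h).reversibles⟩
  obtain ⟨k, hk, h⟩ := h0
  exact ⟨k, hk, h.reversibles⟩
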